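/- For a scheme $X$ of finite type over $\mathbb{Z}$ let $\zeta_X(s)=\prod_{x\in|X|}(1-N(x)^{-s})^{-1}$, where $x$ runs over the closed points of $X$ and $N(x)$ is the number of elements of the residue field of $x$. For a commutative ring $R$ let $\mathbb{G}_{m,R}=\mathrm{spec}\,R[T,T^{-1}]$, and for $n\ge 1$ let $\mu_{n,R}=\mathrm{spec}\,R[T,T^{-1}]/(T^n-1)$, a closed subscheme of $\mathbb{G}_{m,R}$; let $\mu^*_{n,R}=\mu_{n,R}\setminus\bigcup_{d\mid n,\,d\ne n}\mu_{d,R}$, an open subscheme of $\mu_{n,R}$. A point of $\mathbb{G}_{m,R}$ is called torsion if it lies on $\mu_{n,R}$ for some $n\ge1$, and the least such $n$ is its order. For a number field $F$ and $n\ge1$ the modified Dedekind zeta function is $\prod_{\mathfrak{q}\nmid n}(1-N\mathfrak{q}^{-s})^{-1}$, where $\mathfrak{q}$ runs over the maximal ideals of $\mathfrak{o}_F$ not dividing $n$. (a) Let $K$ be a number field with ring of integers $\mathfrak{o}_K$ and Dedekind zeta function $\zeta_K$. For every closed torsion point $P$ of $\mathbb{G}_{m,K}$ the residue field $K_P$ is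 a number field. Denote by $\tilde\zeta_{K_P}(s)$ the modified Dedekind zeta function of $K_P$ for $n$ equal to the order of $P$. For all $s\in\mathbb{C}$ with $\mathrm{Re}\,s>2$, the Euler products of $\zeta_{\mathbb{G}_{m,\mathfrak{o}_K}}(s)$ and of all $\tilde\zeta_{K_P}(s)$ converge unconditionally, $\zeta_K(s)\neq0$, and $$\zeta_{\mathbb{G}_{m,\mathfrak{o}_K}}(s)=\frac{\zeta_K(s-1)}{\zeta_K(s)}=\prod_P\tilde\zeta_{K_P}(s),$$ where $P$ runs over the closed torsion points of $\mathbb{G}_{m,K}$ and the product converges unconditionally. (b) For every $n\ge1$ and every primitive $n$-th root of unity $\zeta_n$ in $\mathbb{Q}(\zeta_n)$ there is an isomorphism $\mathrm{spec}\,\mathbb{Z}[1/n,\zeta_n]\cong\mu^*_{n,\mathbb{Z}}$ whose composite with the inclusion $\mu^*_{n,\mathbb{Z}}\to\mathbb{G}_{m,\mathbb{Z}}$ is given by $T\mapsto\zeta_n$. (c) Let $\tilde\zeta_{\mathbb{Q}(\zeta_n)}(s)$ be the modified Dedekind zeta function of $\mathbb{Q}(\zeta_n)$ for $n$. For all $s\in\mathbb{C}$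 with $\mathrm{Re}\,s>2$, the Euler products of $\zeta_{\mathbb{G}_{m,\mathbb{Z}}}(s)$ and of all $\tilde\zeta_{\mathbb{Q}(\zeta_n)}(s)$ converge unconditionally, and $$\zeta_{\mathbb{G}_{m,\mathbb{Z}}}(s)=\prod_{n=1}^\infty\tilde\zeta_{\mathbb{Q}(\zeta_n)}(s),$$ where the product converges unconditionally. -/

import Mathlib

open AlgebraicGeometry CategoryTheory
open scoped LaurentPolynomial

universe u

namespace GmZeta

noncomputable section

/-! ### Hasse-Weil zeta functions -/

/-- The Euler factor `(1 - N(x)^{-s})⁻¹` of a scheme at a closed point `x`, where `N(x)` is the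
number of elements of the residue field of `x`. -/
def eulerFactor (X : Scheme.{u}) (s : ℂ) (x : closedPoints X) : ℂ :=
  (1 - (Nat.card (X.residueField x.1) : ℂ) ^ (-s))⁻¹

/-- The Hasse-Weil zeta function `ζ_X(s) = ∏_{x ∈ |X|} (1 - N(x)^{-s})⁻¹`, the product running over
the closed points of `X`. -/
def hasseWeilZeta (X : Scheme.{u}) (s : ℂ) : ℂ :=
  ∏' x : closedPoints X, eulerFactor X s x

/-! ### Modified Dedekind zeta functions -/

/-- The Euler factor `(1 - N(q)^{-s})⁻¹` at a maximal ideal `q` of the ring of integers of `F`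
that does not divide `n`. -/
def modifiedDedekindFactor (F : Type u) [Field F] (n : ℕ) (s : ℂ)
    (q : {q : IsDedekindDomain.HeightOneSpectrum (NumberField.RingOfIntegers F) //
      (n : NumberField.RingOfIntegers F) ∉ q.asIdeal}) : ℂ :=
  (1 - (Nat.card (NumberField.RingOfIntegers F ⧸ q.1.asIdeal) : ℂ) ^ (-s))⁻¹

/-- The modified Dedekind zeta function `∏_{q ∤ n} (1 - N(q)^{-s})⁻¹` of the number field `F`. -/
def modifiedDedekindZeta (F : Type u) [Field F] (n : ℕ) (s : ℂ) : ℂ :=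
  ∏' q, modifiedDedekindFactor F n s q

/-! ### The multiplicative group and the group schemes of roots of unity -/

section Gm

variable (R : Type u) [CommRing R]

/-- The multiplicative group over `R`, as a scheme: `Spec R[T, T⁻¹]`. -/
def Gm : Scheme.{u} := Spec (.of R[T;T⁻¹])

/-- The coordinate ring `R[T, T⁻¹] / (T ^ n - 1)` of the kernel of multiplication by `n`. -/
abbrev MuRing (n : ℕ) : Type u :=
  R[T;T⁻¹] ⧸ Ideal.span {(LaurentPolynomial.T (n : ℤ) - 1 : R[T;T⁻¹])}

/-- The group scheme `μ_n` over `R`, as a scheme. -/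
def Mu (n : ℕ) : Scheme.{u} := Spec (.of (MuRing R n))

/-- The closed immersion `μ_n ⟶ 𝔾_m`. -/
def muIncl (n : ℕ) : Mu R n ⟶ Gm R :=
  Spec.map (CommRingCat.ofHom
    (Ideal.Quotient.mk (Ideal.span {(LaurentPolynomial.T (n : ℤ) - 1 : R[T;T⁻¹])})))

instance (n : ℕ) : IsClosedImmersion (muIncl R n) :=
  IsClosedImmersion.spec_of_surjective _ Ideal.Quotient.mk_surjective

/-- The open subscheme `μ_n^*` of `μ_n` of points of order `n`: the complement of the union of the
`μ_d` for `d ∣ n`, `d ≠ n`. (It is used for `n ≥ 1` only.) -/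
def muStar (n : ℕ) : (Mu R n).Opens :=
  ⟨(⋃ d ∈ n.properDivisors, muIncl R n ⁻¹' Set.range (muIncl R d))ᶜ, by
    rw [isOpen_compl_iff]
    exact n.properDivisors.finite_toSet.isClosed_biUnion fun d _ ↦
      (muIncl R d).isClosedEmbedding.isClosed_range.preimage (muIncl R n).continuous⟩

/-- A point of `𝔾_m` is torsion if it lies on `μ_n` for some `n ≥ 1`. -/
def IsTorsionPoint (P : Gm R) : Prop :=
  ∃ n : ℕ, 0 < n ∧ P ∈ Set.range (muIncl R n)

/-- The order of a torsion point `P` of `𝔾_m`: the least `n ≥ 1` such that `P` lies on `μ_n`. -/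
def pointOrder (P : Gm R) : ℕ :=
  sInf {n : ℕ | 0 < n ∧ P ∈ Set.range (muIncl R n)}

/-- The closed torsion points of `𝔾_m`. -/
abbrev ClosedTorsionPoint : Type u :=
  {P : Gm R // P ∈ closedPoints (Gm R) ∧ IsTorsionPoint R P}

end Gm

/-- The subring `ℤ[1/n, ζ]` of the cyclotomic field `ℚ(ζ_n)`. -/
def cyclotomicSubring (n : ℕ) (ζ : CyclotomicField n ℚ) : Subalgebra ℤ (CyclotomicField n ℚ) :=
  Algebra.adjoin ℤ {(n : CyclotomicField n ℚ)⁻¹, ζ}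

end

end GmZeta

/-!
The zeta functions of this file are Euler products over maximal ideals `M` with local factors
`(1 - N(M)⁻ˢ)⁻¹` (`normPow s M` stands for `N(M)⁻ˢ`), and all the factorizations come from
partitioning a maximal spectrum.

The partitions have a common source, `sigmaEquivMaximalSpectrum`. Let `φ i : A → B i` be integral
homomorphisms such that `n i` multiplies `B i` into the image of `φ i`. If each maximal ideal of `A`
contains `ker (φ i)` but not `n i` for exactly one `i`, then the maximal spectrum of `A` is the
disjoint union of those of the `B i` with the divisors of `n i` removed, and residue fields agree.
For `Re s > 2` everything converges absolutely, so the Euler product of `A` is the product of those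
of the pieces (`hasProd_tprod_normPow`).

*Vertical partition.* The fibres `𝓞 K[X] → (𝓞 K ⧸ p)[X]` partition the affine line. The zeta
function of the affine line over a field with `q` elements is the sum over monic polynomials
`∑ qⁿ q⁻ⁿˢ = (1 - q¹⁻ˢ)⁻¹`, by unique factorization; so the zeta function of the affine line over
`𝓞 K` is `ζ_K(s - 1)`. Removing the origin divides it by `ζ_K(s)`, the Euler product of which is
again unique factorization of ideals. This also yields the absolute convergence.

*Horizontal partition.* A closed point `M` of `𝔾_m` over `𝓞 K` has a finite residue field, so the
class of `T` in it is a root of unity of some order `n` prime to the characteristic. Hence `M`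
contains a monic irreducible factor `f` of `Xⁿ - 1` over `𝓞 K`, that is, it specializes a closed
torsion point `P` of `𝔾_{m,K}`; and `P` is unique because `Xⁿ - 1` is separable modulo `M`
(`eq_of_dvd_X_pow_sub_one`). If `ζ` is the image of `T` in the residue field `L` of `P`, then
`n 𝓞 L ⊆ 𝓞 K[ζ]`, since the conductor of `𝓞 K[ζ]` contains `f'(ζ)`, a divisor of `n ζⁿ⁻¹`
(`natCast_mul_mem_adjoin`). Thus the closed points specializing `P`, with residue characteristic
prime to the order of `P`, are the primes of `L` not dividing that order. Over `ℤ` the factor `f` is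
a cyclotomic polynomial, which indexes the pieces by `n ≥ 1` instead.

*Points of order `n`.* The open subscheme `μ_n^*` of `μ_n` is the nonvanishing locus of
`g = ∏ (T ^ d - 1)`, over the proper divisors `d` of `n`. The ring `ℤ[1/n, ζ_n]` is the localization
of the coordinate ring of `μ_n` at `g`: the identity `∏_{0 < j < n} (1 - ζ_n ^ j) = n` shows that
`g(ζ_n)` and `n` divide powers of each other, and `g` kills the ideal generated by `Φ_n(T)`.
-/

namespace GmZeta

/-! ### Euler products over free commutative monoids -/

/-- Finite partial Euler product: only the exponent vectors supported in `S` contribute. -/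
theorem hasSum_prod_pow_of_support_subset {ι : Type*} [DecidableEq ι] {a : ι → ℂ}
    (ha : ∀ i, ‖a i‖ < 1) (S : Finset ι) :
    HasSum (fun f : {f : ι →₀ ℕ // f.support ⊆ S} ↦ f.1.prod fun i k ↦ a i ^ k)
      (∏ i ∈ S, (1 - a i)⁻¹) ∧
    Summable (fun f : {f : ι →₀ ℕ // f.support ⊆ S} ↦ ‖f.1.prod fun i k ↦ a i ^ k‖) := by
  induction S using Finset.induction_on with
  | empty =>
    have : Unique {f : ι →₀ ℕ // f.support ⊆ ∅} :=
      ⟨⟨⟨0, by simp⟩⟩, fun f ↦ Subtype.ext (by simpa using f.2)⟩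
    refine ⟨?_, (hasSum_fintype _).summable⟩
    convert hasSum_fintype (fun f : {f : ι →₀ ℕ // f.support ⊆ ∅} ↦ f.1.prod fun i k ↦ a i ^ k)
    rw [Fintype.sum_unique]
    have : (default : {f : ι →₀ ℕ // f.support ⊆ ∅}).1 = 0 := by
      simpa using (default : {f : ι →₀ ℕ // f.support ⊆ ∅}).2
    simp [this]
  | insert i S hi ih =>
    -- split off the exponent of `i`
    let e : ℕ × {f : ι →₀ ℕ // f.support ⊆ S} ≃ {f : ι →₀ ℕ // f.support ⊆ insert i S} :=
      { toFun := fun x ↦ ⟨x.2.1 + Finsupp.single i x.1, by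
          refine Finsupp.support_add.trans (Finset.union_subset
            (x.2.2.trans (Finset.subset_insert _ _)) ?_)
          exact Finsupp.support_single_subset.trans (by simp)⟩
        invFun := fun f ↦ ⟨f.1 i, ⟨f.1.erase i, by
          rw [Finsupp.support_erase, ← Finset.subset_insert_iff]
          exact f.2⟩⟩
        left_inv := by
          rintro ⟨k, f, hf⟩
          have hfi : f i = 0 := by
            by_contra h
            exact hi (hf (Finsupp.mem_support_iff.mpr h))
          refine Prod.ext (by simp [hfi]) (Subtype.ext ?_)
          ext j
          by_cases hj : j = i
          · subst hj; simp [hfi]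
          · simp [Finsupp.erase_ne hj]
        right_inv := by
          rintro ⟨f, hf⟩
          exact Subtype.ext (Finsupp.erase_add_single i f) }
    have key : ∀ x : ℕ × {f : ι →₀ ℕ // f.support ⊆ S},
        ((e x).1.prod fun i k ↦ a i ^ k) = a i ^ x.1 * x.2.1.prod fun i k ↦ a i ^ k := by
      intro x
      change ((x.2.1 + Finsupp.single i x.1).prod fun i k ↦ a i ^ k) = _
      rw [Finsupp.prod_add_index' (by simp) (by simp [pow_add]), mul_comm]
      simp
    have hg : Summable fun n : ℕ ↦ ‖a i ^ n‖ := by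
      simpa using summable_geometric_of_lt_one (norm_nonneg _) (ha i)
    have hs := summable_mul_of_summable_norm hg ih.2
    have hs' := hg.mul_norm ih.2
    have hsum := (hasSum_geometric_of_norm_lt_one (ha i)).mul ih.1 hs
    rw [← Finset.prod_insert hi (f := fun i ↦ (1 - a i)⁻¹)] at hsum
    clear_value e
    refine ⟨?_, ?_⟩
    · rw [← e.hasSum_iff]
      simpa only [Function.comp_def, key] using hsum
    · rw [← e.summable_iff]
      exact hs'.congr fun x ↦ congrArg norm (key x).symm

/-- The Euler product formula for the free commutative monoid on `ι`. -/
theorem hasProd_inv_one_sub_of_summable {ι : Type*} {a : ι → ℂ}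
    (h : Summable fun f : ι →₀ ℕ ↦ ‖f.prod fun i k ↦ a i ^ k‖) :
    HasProd (fun i ↦ (1 - a i)⁻¹) (∑' f : ι →₀ ℕ, f.prod fun i k ↦ a i ^ k) := by
  classical
  have ha : ∀ i, ‖a i‖ < 1 := by
    intro i
    have := h.comp_injective (Finsupp.single_injective i)
    have h2 : Summable fun n : ℕ ↦ ‖a i‖ ^ n := by simpa [Function.comp_def] using this
    simpa using summable_geometric_iff_norm_lt_one.mp h2
  have hfin : ∀ S : Finset ι, ∏ i ∈ S, (1 - a i)⁻¹ =
      ∑' f : ι →₀ ℕ, Set.indicator {f : ι →₀ ℕ | f.support ⊆ S}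
        (fun f ↦ f.prod fun i k ↦ a i ^ k) f := by
    intro S
    rw [← (hasSum_prod_pow_of_support_subset ha S).1.tsum_eq]
    exact tsum_subtype {f : ι →₀ ℕ | f.support ⊆ S} (fun f ↦ f.prod fun i k ↦ a i ^ k)
  rw [HasProd, SummationFilter.unconditional_filter]
  simp_rw [hfin]
  refine tendsto_tsum_of_dominated_convergence h (fun f ↦ ?_) (.of_forall fun S f ↦ ?_)
  · refine tendsto_const_nhds.congr' ?_
    filter_upwards [Filter.eventually_ge_atTop f.support] with S hS
    exact (Set.indicator_of_mem (s := {f : ι →₀ ℕ | f.support ⊆ S}) hS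
      (fun f ↦ f.prod fun i k ↦ a i ^ k)).symm
  · exact norm_indicator_le_norm_self _ _

theorem multipliable_inv_one_sub {ι : Type*} {a : ι → ℂ} (h : Summable fun i ↦ ‖a i‖)
    (ha : ∀ i, ‖a i‖ ≤ 1 / 2) : Multipliable fun i ↦ (1 - a i)⁻¹ := by
  have h1 : ∀ i, 1 / 2 ≤ ‖1 - a i‖ := fun i ↦ by
    have := norm_sub_norm_le (1 : ℂ) (a i)
    rw [norm_one] at this
    linarith [ha i]
  have h2 : (fun i ↦ (1 - a i)⁻¹) = fun i ↦ 1 + a i * (1 - a i)⁻¹ := funext fun i ↦ by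
    have : 1 - a i ≠ 0 := norm_pos_iff.mp (by linarith [h1 i])
    field_simp
    ring
  rw [h2]
  refine multipliable_one_add_of_summable (Summable.of_nonneg_of_le (fun _ ↦ norm_nonneg _)
    (fun i ↦ ?_) (h.mul_left 2))
  rw [norm_mul, norm_inv, mul_comm 2]
  gcongr
  rw [inv_le_comm₀ (by linarith [h1 i]) (by norm_num)]
  linarith [h1 i]

/-! ### Euler products over the ideals of a Dedekind domain -/

open IsDedekindDomain

section Dedekind

variable {D : Type*} [CommRing D] [IsDedekindDomain D]

/-- Unique factorization of ideals, as a bijection from exponent vectors to nonzero ideals. -/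
noncomputable def finsuppEquivIdeal :
    (HeightOneSpectrum D →₀ ℕ) ≃ {I : Ideal D // I ≠ ⊥} :=
  Equiv.ofBijective
    (fun f ↦ ⟨((Finsupp.toMultiset f).map HeightOneSpectrum.asIdeal).prod, by
      rw [← Ideal.zero_eq_bot]
      refine Multiset.prod_ne_zero fun h ↦ ?_
      obtain ⟨p, -, hp⟩ := Multiset.mem_map.mp h
      exact p.ne_bot hp⟩) <| by
    classical
    have hprime : ∀ m : Multiset (HeightOneSpectrum D),
        ∀ p ∈ m.map HeightOneSpectrum.asIdeal, Prime p := by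
      intro m p hp
      obtain ⟨p, -, rfl⟩ := Multiset.mem_map.mp hp
      exact p.prime
    constructor
    · intro f g hfg
      have h := congrArg UniqueFactorizationMonoid.normalizedFactors (Subtype.ext_iff.mp hfg)
      simp only at h
      rw [UniqueFactorizationMonoid.normalizedFactors_prod_of_prime (hprime _),
        UniqueFactorizationMonoid.normalizedFactors_prod_of_prime (hprime _)] at h
      exact Multiset.toFinsupp.symm.injective
        (Multiset.map_injective (fun p q h ↦ HeightOneSpectrum.ext h) h)
    · rintro ⟨I, hI⟩
      suffices ∃ m : Multiset (HeightOneSpectrum D),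
          (m.map HeightOneSpectrum.asIdeal).prod = I by
        obtain ⟨m, rfl⟩ := this
        exact ⟨Multiset.toFinsupp m, by simp⟩
      induction I using UniqueFactorizationMonoid.induction_on_prime with
      | h₁ => exact absurd rfl hI
      | h₂ x hx => exact ⟨0, by simpa using (Ideal.isUnit_iff.mp hx).symm⟩
      | h₃ J p hJ hp ih =>
        obtain ⟨m, rfl⟩ := ih hJ
        exact ⟨⟨p, Ideal.isPrime_of_prime hp, hp.ne_zero⟩ ::ₘ m, by simp⟩

theorem coe_finsuppEquivIdeal (f : HeightOneSpectrum D →₀ ℕ) :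
    (finsuppEquivIdeal f).1 = f.prod fun p k ↦ p.asIdeal ^ k := by
  change ((Finsupp.toMultiset f).map HeightOneSpectrum.asIdeal).prod = _
  rw [Finsupp.toMultiset_map, Finsupp.prod_toMultiset, Finsupp.prod_mapDomain_index] <;>
    simp [pow_add]

/-- The Euler product of a completely multiplicative function on the nonzero ideals of a Dedekind
domain. -/
theorem hasProd_inv_one_sub_heightOneSpectrum (χ : Ideal D →* ℂ)
    (h : Summable fun I : {I : Ideal D // I ≠ ⊥} ↦ ‖χ I‖) :
    HasProd (fun p : HeightOneSpectrum D ↦ (1 - χ p.asIdeal)⁻¹)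
      (∑' I : {I : Ideal D // I ≠ ⊥}, χ I) := by
  have key : ∀ f : HeightOneSpectrum D →₀ ℕ,
      χ (finsuppEquivIdeal f).1 = f.prod fun p k ↦ χ p.asIdeal ^ k := fun f ↦ by
    rw [coe_finsuppEquivIdeal, Finsupp.prod, Finsupp.prod, map_prod]
    simp
  rw [← finsuppEquivIdeal.tsum_eq]
  rw [← finsuppEquivIdeal.summable_iff] at h
  simp only [Function.comp_def, key] at h ⊢
  exact hasProd_inv_one_sub_of_summable h

end Dedekind

/-! ### Gluing Euler products along a family of integral ring homomorphisms -/

section Gluing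

theorem comap_isMaximal_of_isIntegral {A B : Type*} [CommRing A] [CommRing B] {φ : A →+* B}
    (hφ : φ.IsIntegral) (q : MaximalSpectrum B) : (q.asIdeal.comap φ).IsMaximal :=
  have := q.isMaximal
  Ideal.isMaximal_comap_of_isIntegral_of_isMaximal' φ hφ q.asIdeal

/-- If `φ : A → B` is integral and its image contains `n B`, then the maximal ideals of `B` not
containing `n` are in bijection with the maximal ideals of `A` that contain `ker φ` but not `n`. -/
noncomputable def maximalSpectrumEquivOfIsIntegral {A B : Type*} [CommRing A] [CommRing B]
    (φ : A →+* B) (n : ℕ) (hφ : φ.IsIntegral) (hn : ∀ b, ∃ a, φ a = n * b) :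
    {q : MaximalSpectrum B // (n : B) ∉ q.asIdeal} ≃
      {M : MaximalSpectrum A // RingHom.ker φ ≤ M.asIdeal ∧ (n : A) ∉ M.asIdeal} :=
  Equiv.ofBijective
    (fun q ↦ ⟨⟨q.1.asIdeal.comap φ, comap_isMaximal_of_isIntegral hφ q.1⟩,
      Ideal.ker_le_comap φ, by simpa using q.2⟩) <| by
    constructor
    · rintro ⟨q, hq⟩ ⟨q', hq'⟩ h
      have h : q.asIdeal.comap φ = q'.asIdeal.comap φ :=
        congrArg MaximalSpectrum.asIdeal (Subtype.ext_iff.mp h)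
      have hle : q.asIdeal ≤ q'.asIdeal := by
        intro b hb
        obtain ⟨a, ha⟩ := hn b
        have h1 : a ∈ q.asIdeal.comap φ := by
          rw [Ideal.mem_comap, ha]
          exact q.asIdeal.mul_mem_left _ hb
        rw [h, Ideal.mem_comap, ha] at h1
        exact (q'.isMaximal.isPrime.mem_or_mem h1).resolve_left hq'
      exact Subtype.ext (MaximalSpectrum.ext
        (q.isMaximal.eq_of_le q'.isMaximal.ne_top hle))
    · rintro ⟨M, hM, hnM⟩
      algebraize [φ]
      have : Algebra.IsIntegral A B := ⟨hφ⟩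
      have := M.isMaximal
      obtain ⟨Q, hQ, hQM⟩ := Ideal.exists_ideal_over_maximal_of_isIntegral (S := B) M.asIdeal hM
      refine ⟨⟨⟨Q, hQ⟩, fun h ↦ hnM ?_⟩, Subtype.ext (MaximalSpectrum.ext hQM)⟩
      rw [← hQM, Ideal.mem_comap]
      simpa using h

theorem card_quotient_comap {A B : Type*} [CommRing A] [CommRing B] {φ : A →+* B} {n : ℕ}
    (hφ : φ.IsIntegral) (hn : ∀ b, ∃ a, φ a = n * b) (q : MaximalSpectrum B)
    (hq : (n : B) ∉ q.asIdeal) :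
    Nat.card (A ⧸ q.asIdeal.comap φ) = Nat.card (B ⧸ q.asIdeal) := by
  have := comap_isMaximal_of_isIntegral hφ q
  refine Nat.card_congr (Equiv.ofBijective (Ideal.quotientMap q.asIdeal φ le_rfl)
    ⟨Ideal.quotientMap_injective, fun b ↦ ?_⟩)
  obtain ⟨b, rfl⟩ := Ideal.Quotient.mk_surjective b
  obtain ⟨a, ha⟩ := hn b
  -- `n` is invertible in the field `A ⧸ φ⁻¹ q`
  have hnA : (n : A) ∉ q.asIdeal.comap φ := by simpa using hq
  obtain ⟨c, m, hm, hc⟩ := this.exists_inv hnA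
  refine ⟨Ideal.Quotient.mk _ (c * a), ?_⟩
  rw [Ideal.quotientMap_mk, Ideal.Quotient.eq, map_mul, ha]
  have h1 : φ c * n - 1 ∈ q.asIdeal := by
    have : φ c * n + φ m = 1 := by
      rw [← map_natCast φ, ← map_mul, ← map_add, hc, map_one]
    rw [← this, sub_add_cancel_left]
    exact q.asIdeal.neg_mem hm
  convert q.asIdeal.mul_mem_right b h1 using 1
  ring

/-- The quantity `N(I)^{-s}` attached to an ideal `I` with `N(I)` cosets. For an ideal of infinite
index it is `0 ^ (-s)`, which vanishes for `s ≠ 0`. -/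
noncomputable def normPow {A : Type*} [CommRing A] (s : ℂ) (I : Ideal A) : ℂ :=
  (Nat.card (A ⧸ I) : ℂ) ^ (-s)

theorem norm_normPow {A : Type*} [CommRing A] {s : ℂ} (hs : s.re ≠ 0) (I : Ideal A) :
    ‖normPow s I‖ = (Nat.card (A ⧸ I) : ℝ) ^ (-s.re) := by
  rw [normPow, Complex.norm_natCast_cpow_of_re_ne_zero _ (by simpa using hs), Complex.neg_re]

theorem norm_normPow_le {A : Type*} [CommRing A] {s : ℂ} (hs : 1 < s.re) (I : Ideal A)
    [I.IsMaximal] : ‖normPow s I‖ ≤ 1 / 2 := by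
  rw [norm_normPow (by linarith)]
  rcases (Nat.card (A ⧸ I)).eq_zero_or_pos with h | h
  · rw [h, Nat.cast_zero, Real.zero_rpow (by linarith)]
    norm_num
  have : Finite (A ⧸ I) := Nat.finite_of_card_ne_zero h.ne'
  have : Nontrivial (A ⧸ I) := Ideal.Quotient.nontrivial_iff.mpr (Ideal.IsMaximal.ne_top ‹_›)
  have h2 : (2 : ℝ) ≤ Nat.card (A ⧸ I) := by exact_mod_cast Finite.one_lt_card
  calc (Nat.card (A ⧸ I) : ℝ) ^ (-s.re) ≤ (2 : ℝ) ^ (-s.re) :=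
        Real.rpow_le_rpow_of_nonpos (by norm_num) h2 (by linarith)
    _ ≤ (2 : ℝ) ^ (-1 : ℝ) := Real.rpow_le_rpow_of_exponent_le (by norm_num) (by linarith)
    _ = 1 / 2 := by rw [Real.rpow_neg_one]; norm_num

/-- Euler products over sets of maximal ideals converge as soon as the norms are summable. -/
theorem multipliable_normPow {A ι : Type*} [CommRing A] {s : ℂ} (hs : 1 < s.re)
    (M : ι → MaximalSpectrum A) (h : Summable fun i ↦ ‖normPow s (M i).asIdeal‖) :
    Multipliable fun i ↦ (1 - normPow s (M i).asIdeal)⁻¹ :=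
  multipliable_inv_one_sub h fun i ↦ have := (M i).isMaximal; norm_normPow_le hs _

variable {A ι : Type*} [CommRing A] {B : ι → Type*} [∀ i, CommRing (B i)]
  (φ : ∀ i, A →+* B i) (n : ι → ℕ)

/-- If every maximal ideal of `A` contains `ker (φ i)` but not `n i` for exactly one `i`, then the
maximal spectrum of `A` is the disjoint union of the maximal spectra of the `B i` with the
divisors of `n i` removed. -/
noncomputable def sigmaEquivMaximalSpectrum
    (hφ : ∀ i, (φ i).IsIntegral) (hn : ∀ i b, ∃ a, φ i a = n i * b)
    (h : ∀ M : MaximalSpectrum A, ∃! i, RingHom.ker (φ i) ≤ M.asIdeal ∧ (n i : A) ∉ M.asIdeal) :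
    (Σ i, {q : MaximalSpectrum (B i) // (n i : B i) ∉ q.asIdeal}) ≃ MaximalSpectrum A :=
  (Equiv.sigmaCongrRight fun i ↦ maximalSpectrumEquivOfIsIntegral (φ i) (n i) (hφ i) (hn i)).trans
    (Equiv.ofBijective (fun x ↦ x.2.1) <| by
      constructor
      · rintro ⟨i, M, hM⟩ ⟨j, M', hM'⟩ (rfl : M = M')
        obtain rfl := (h M).unique hM hM'
        rfl
      · intro M
        obtain ⟨i, hi, -⟩ := h M
        exact ⟨⟨i, M, hi⟩, rfl⟩)

/-- Under a decomposition of the maximal spectrum as in `sigmaEquivMaximalSpectrum`, the Euler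
product of `A` is the product of the Euler products of the pieces. -/
theorem hasProd_tprod_normPow
    (hφ : ∀ i, (φ i).IsIntegral) (hn : ∀ i b, ∃ a, φ i a = n i * b)
    (h : ∀ M : MaximalSpectrum A, ∃! i, RingHom.ker (φ i) ≤ M.asIdeal ∧ (n i : A) ∉ M.asIdeal)
    {s : ℂ} (hs : 1 < s.re)
    (hsum : Summable fun M : MaximalSpectrum A ↦ ‖normPow s M.asIdeal‖) :
    (∀ i, Multipliable fun q : {q : MaximalSpectrum (B i) // (n i : B i) ∉ q.asIdeal} ↦
      (1 - normPow s q.1.asIdeal)⁻¹) ∧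
    HasProd (fun i ↦ ∏' q : {q : MaximalSpectrum (B i) // (n i : B i) ∉ q.asIdeal},
      (1 - normPow s q.1.asIdeal)⁻¹) (∏' M : MaximalSpectrum A, (1 - normPow s M.asIdeal)⁻¹) := by
  obtain ⟨e, key⟩ : ∃ e : (Σ i, {q : MaximalSpectrum (B i) // (n i : B i) ∉ q.asIdeal}) ≃
      MaximalSpectrum A, ∀ x, normPow s (e x).asIdeal = normPow s x.2.1.asIdeal := by
    refine ⟨sigmaEquivMaximalSpectrum φ n hφ hn h, ?_⟩
    rintro ⟨i, q, hq⟩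
    exact congrArg (fun k : ℕ ↦ (k : ℂ) ^ (-s)) (card_quotient_comap (hφ i) (hn i) q hq)
  have h1 : ∀ i, Multipliable fun q : {q : MaximalSpectrum (B i) // (n i : B i) ∉ q.asIdeal} ↦
      (1 - normPow s q.1.asIdeal)⁻¹ := by
    intro i
    refine multipliable_normPow (A := B i) hs
      (fun q : {q : MaximalSpectrum (B i) // (n i : B i) ∉ q.asIdeal} ↦ q.1) ?_
    have h2 : Function.Injective fun q : {q : MaximalSpectrum (B i) // (n i : B i) ∉ q.asIdeal} ↦
        e ⟨i, q⟩ := e.injective.comp sigma_mk_injective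
    have h3 := hsum.comp_injective h2
    simp only [Function.comp_def] at h3
    simpa only [key] using h3
  refine ⟨h1, ?_⟩
  have h2 := (multipliable_normPow hs (fun M : MaximalSpectrum A ↦ M) hsum).hasProd
  rw [← e.hasProd_iff] at h2
  have h3 : HasProd (fun x : (Σ i, {q : MaximalSpectrum (B i) // (n i : B i) ∉ q.asIdeal}) ↦
      (1 - normPow s x.2.1.asIdeal)⁻¹) (∏' M : MaximalSpectrum A, (1 - normPow s M.asIdeal)⁻¹) := by
    convert h2 using 1
    exact funext fun x ↦ by rw [Function.comp_apply, key]
  exact h3.sigma fun i ↦ (h1 i).hasProd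

end Gluing

/-! ### Evaluating Laurent polynomials at units -/

section LaurentEval

open Polynomial

theorem mul_T_mem_iff {R : Type*} [CommRing R] {I : Ideal R[T;T⁻¹]} {a : R[T;T⁻¹]} {n : ℤ} :
    a * LaurentPolynomial.T n ∈ I ↔ a ∈ I :=
  Ideal.mul_unit_mem_iff_mem I (LaurentPolynomial.isUnit_T n)

variable {R B : Type*} [CommRing R] [CommRing B] [Algebra R B]

/-- Evaluation of Laurent polynomials at a unit of an algebra. -/
noncomputable abbrev laurentEval (u : Bˣ) : R[T;T⁻¹] →+* B :=
  LaurentPolynomial.eval₂ (algebraMap R B) u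

theorem laurentEval_toLaurent (u : Bˣ) (p : R[X]) :
    laurentEval u (toLaurent p) = aeval (u : B) p := by
  rw [LaurentPolynomial.eval₂_toLaurent, aeval_def]

theorem toLaurent_X_pow_sub_one (n : ℕ) :
    toLaurent (X ^ n - 1 : R[X]) = LaurentPolynomial.T (n : ℤ) - 1 := by
  rw [map_sub, Polynomial.toLaurent_X_pow, map_one]

/-- A ring homomorphism out of the Laurent polynomials is evaluation at the image of `T`. -/
theorem exists_eq_laurentEval (φ : R[T;T⁻¹] →+* B)
    (hφ : ∀ r, φ (LaurentPolynomial.C r) = algebraMap R B r) :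
    ∃ u : Bˣ, φ = laurentEval u := by
  refine ⟨(LaurentPolynomial.isUnit_T 1).unit.map (φ : R[T;T⁻¹] →* B),
    IsLocalization.ringHom_ext (Submonoid.powers (X : R[X]))
      (Polynomial.ringHom_ext (fun r ↦ ?_) ?_)⟩
  · simp [LaurentPolynomial.algebraMap_eq_toLaurent, hφ]
  · simp [LaurentPolynomial.algebraMap_eq_toLaurent]

theorem T_sub_one_mem_ker_iff (u : Bˣ) (n : ℕ) :
    LaurentPolynomial.T (n : ℤ) - 1 ∈ RingHom.ker (laurentEval (R := R) u) ↔ (u : B) ^ n = 1 := by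
  rw [RingHom.mem_ker, map_sub, map_one, LaurentPolynomial.eval₂_T_n, sub_eq_zero]

/-- The kernel of evaluation at an integral unit is generated by its minimal polynomial. -/
theorem ker_laurentEval_le_iff [IsDomain R] [IsIntegrallyClosed R] [IsDomain B]
    [Module.IsTorsionFree R B] (u : Bˣ) (hu : IsIntegral R (u : B)) (I : Ideal R[T;T⁻¹]) :
    RingHom.ker (laurentEval (R := R) u) ≤ I ↔ toLaurent (minpoly R (u : B)) ∈ I := by
  refine ⟨fun h ↦ h ?_, fun h a ha ↦ ?_⟩
  · rw [RingHom.mem_ker, laurentEval_toLaurent, minpoly.aeval]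
  · obtain ⟨n, p, hp⟩ := a.exists_T_pow
    rw [← mul_T_mem_iff (n := n), ← hp]
    have h1 : aeval (u : B) p = 0 := by
      rw [← laurentEval_toLaurent, hp, map_mul, RingHom.mem_ker.mp ha, zero_mul]
    obtain ⟨q, rfl⟩ := minpoly.isIntegrallyClosed_dvd hu h1
    rw [map_mul]
    exact I.mul_mem_right _ h

theorem range_laurentEval_of_mem_adjoin (u : Bˣ) {b : B} (hb : b ∈ Algebra.adjoin R {(u : B)}) :
    ∃ a, laurentEval (R := R) u a = b := by
  rw [Algebra.adjoin_singleton_eq_range_aeval] at hb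
  obtain ⟨p, rfl⟩ := hb
  exact ⟨toLaurent p, laurentEval_toLaurent u p⟩

theorem laurentEval_isIntegral [Algebra.IsIntegral R B] (u : Bˣ) :
    (laurentEval (R := R) u).IsIntegral := by
  refine RingHom.IsIntegral.tower_top (LaurentPolynomial.C : R →+* R[T;T⁻¹]) _ ?_
  have : (laurentEval (R := R) u).comp LaurentPolynomial.C = algebraMap R B :=
    RingHom.ext fun r ↦ LaurentPolynomial.eval₂_C _ _ r
  rw [this]
  exact Algebra.IsIntegral.isIntegral

end LaurentEval

/-! ### Factors of `X ^ n - 1` -/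

section RootsOfUnity

open Polynomial

variable {R : Type*} [CommRing R] [IsDomain R]

/-- A prime ideal not containing `n` contains at most one of the irreducible factors of `X ^ n - 1`,
since `X ^ n - 1` is separable modulo it. -/
theorem eq_of_dvd_X_pow_sub_one [IsIntegrallyClosed R] {f g : R[X]} (hf : f.Monic) (hg : g.Monic)
    (hfi : Irreducible f) (hgi : Irreducible g) {n : ℕ}
    (hfn : f ∣ X ^ n - 1) (hgn : g ∣ X ^ n - 1) (M : Ideal R[T;T⁻¹]) [M.IsPrime]
    (hfM : toLaurent f ∈ M) (hgM : toLaurent g ∈ M) (hn : (n : R[T;T⁻¹]) ∉ M) : f = g := by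
  by_contra hne
  let K := FractionRing R
  have hfK := (hf.irreducible_iff_irreducible_map_fraction_map (K := K)).mp hfi
  have hgK := (hg.irreducible_iff_irreducible_map_fraction_map (K := K)).mp hgi
  obtain ⟨h, hh⟩ := hfn
  have hgh : g ∣ h := by
    have h1 : g.map (algebraMap R K) ∣ f.map (algebraMap R K) * h.map (algebraMap R K) := by
      rw [← Polynomial.map_mul, ← hh]
      exact Polynomial.map_dvd _ hgn
    rcases hgK.prime.dvd_or_dvd h1 with h2 | h2
    · have h3 := eq_of_monic_of_associated (hg.map (algebraMap R K)) (hf.map (algebraMap R K))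
        (hgK.associated_of_dvd hfK h2)
      exact absurd (Polynomial.map_injective _ (IsFractionRing.injective R K) h3).symm hne
    · exact (Polynomial.map_dvd_map _ (IsFractionRing.injective R K) hg).mp h2
  obtain ⟨k, rfl⟩ := hgh
  have hd := congrArg derivative hh
  simp only [derivative_sub, derivative_one, sub_zero, derivative_X_pow, derivative_mul] at hd
  -- `n T ^ (n - 1)` lies in `M` because every term of the derivative of `f * g * k` does
  have hmem : toLaurent (C (n : R) * X ^ (n - 1)) ∈ M := by
    rw [hd]
    simp only [map_add, map_mul]
    refine M.add_mem (M.mul_mem_left _ (M.mul_mem_right _ hgM)) (M.mul_mem_right _ hfM)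
  rw [Polynomial.toLaurent_C_mul_X_pow, mul_T_mem_iff, map_natCast] at hmem
  exact hn hmem

/-- A prime ideal containing a monic polynomial contains one of its monic irreducible factors. -/
theorem exists_monic_irreducible_dvd (P : Ideal R[X]) [P.IsPrime] {f : R[X]} (hf : f.Monic)
    (hfP : f ∈ P) : ∃ g : R[X], g.Monic ∧ Irreducible g ∧ g ∣ f ∧ g ∈ P := by
  induction h : f.natDegree using Nat.strong_induction_on generalizing f with
  | _ d ih =>
    by_cases hi : Irreducible f
    · exact ⟨f, hf, hi, dvd_rfl, hfP⟩
    have h1 : f ≠ 1 := by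
      rintro rfl
      exact Ideal.IsPrime.ne_top ‹_› (P.eq_top_of_isUnit_mem hfP isUnit_one)
    rw [hf.irreducible_iff_natDegree'] at hi
    push Not at hi
    obtain ⟨a, b, ha, hb, hab, hdeg⟩ := hi h1
    rw [Finset.mem_Ioc] at hdeg
    have hadd : a.natDegree + b.natDegree = d := by rw [← h, ← hab, ha.natDegree_mul hb]
    have hd := Nat.div_le_self f.natDegree 2
    rcases Ideal.IsPrime.mem_or_mem ‹_› (hab ▸ hfP : a * b ∈ P) with hP | hP
    · obtain ⟨g, h1, h2, h3, h4⟩ := ih a.natDegree (by omega) ha hP rfl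
      exact ⟨g, h1, h2, h3.trans (hab ▸ dvd_mul_right a b), h4⟩
    · obtain ⟨g, h1, h2, h3, h4⟩ := ih b.natDegree (by omega) hb hP rfl
      exact ⟨g, h1, h2, h3.trans (hab ▸ dvd_mul_left b a), h4⟩

/-- Let `x` be a root of unity of order dividing `n`, generating the extension `L / K`, and let `B`
be the integral closure of `R` in `L`. Then `n B ⊆ R[x]`: the conductor of `R[x]` contains the
value at `x` of the derivative of the minimal polynomial of `x`, which divides `n x ^ (n - 1)`. -/
theorem natCast_mul_mem_adjoin [IsIntegrallyClosed R] (K : Type*) {L B : Type*} [Field K] [Field L]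
    [CommRing B] [IsDedekindDomain B] [Algebra R K] [IsFractionRing R K] [Algebra R B] [Algebra B L]
    [Algebra K L] [Algebra R L] [IsScalarTower R K L] [IsScalarTower R B L]
    [FiniteDimensional K L] [Algebra.IsSeparable K L] [IsIntegralClosure B R L]
    [Module.IsTorsionFree R B] {x : B} (hx : Algebra.adjoin K {algebraMap B L x} = ⊤)
    {n : ℕ} (hxn : x ^ n = 1) (hn : 0 < n) (b : B) :
    (n : B) * b ∈ Algebra.adjoin R {x} := by
  have hint : IsIntegral R x := IsIntegralClosure.isIntegral R L x
  have hdvd : minpoly R x ∣ X ^ n - 1 :=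
    minpoly.isIntegrallyClosed_dvd hint (by simp [hxn])
  obtain ⟨g, hg⟩ := hdvd
  have hcond : aeval x (derivative (minpoly R x)) ∈ conductor R x := by
    have h1 := Ideal.mem_span_singleton_self (aeval x (derivative (minpoly R x)))
    rw [← conductor_mul_differentIdeal R K L x hx] at h1
    exact (Ideal.mul_le_left : conductor R x * differentIdeal R B ≤ _) h1
  have hd := congrArg (fun p ↦ aeval x (derivative p)) hg
  simp only [derivative_sub, derivative_one, sub_zero, derivative_X_pow, derivative_mul, map_add,
    map_mul, minpoly.aeval, zero_mul, add_zero, map_pow, aeval_X, map_natCast] at hd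
  have : (n : B) * b = x * aeval x g * (aeval x (derivative (minpoly R x)) * b) := by
    calc (n : B) * b = x * (n * x ^ (n - 1)) * b := by
          rw [mul_left_comm, mul_pow_sub_one hn.ne', hxn, mul_one]
      _ = _ := by rw [hd]; ring
  rw [this]
  refine mul_mem (mul_mem (Algebra.self_mem_adjoin_singleton R x) ?_) (mem_conductor_iff.mp hcond b)
  exact aeval_mem_adjoin_singleton R x

end RootsOfUnity

/-! ### The Euler products of Dedekind domains with multiplicative norm -/

section Counting

open IsDedekindDomain

/-- Summation along the fibres of a map to the natural numbers. -/
theorem hasSum_comp_of_card_fiber {S : Type*} (N : S → ℕ) [∀ n, Finite {t // N t = n}] (c : ℕ → ℂ)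
    (h : Summable fun n ↦ (Nat.card {t // N t = n} : ℝ) * ‖c n‖) :
    (Summable fun t ↦ ‖c (N t)‖) ∧
      HasSum (fun t ↦ c (N t)) (∑' n, (Nat.card {t // N t = n} : ℂ) * c n) := by
  have key : ∀ x : (Σ n, {t // N t = n}), N (Equiv.sigmaFiberEquiv N x) = x.1 := fun x ↦ x.2.2
  have h1 : Summable fun t ↦ ‖c (N t)‖ := by
    rw [← (Equiv.sigmaFiberEquiv N).summable_iff]
    simp only [Function.comp_def, key]
    rw [summable_sigma_of_nonneg (fun _ ↦ norm_nonneg _)]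
    refine ⟨fun n ↦ Summable.of_finite, ?_⟩
    simpa only [tsum_const, nsmul_eq_mul] using h
  refine ⟨h1, ?_⟩
  have h2 := h1.of_norm.hasSum
  have h3 := (Equiv.sigmaFiberEquiv N).hasSum_iff.mpr h2
  have h4 := h3.summable.tsum_sigma
  simp only [Function.comp_def, key, tsum_const, nsmul_eq_mul] at h4
  have h5 : ∑' t, c (N t) = ∑' x : (Σ n, {t // N t = n}), c x.1 := by
    rw [← h3.tsum_eq]
    simp only [Function.comp_def, key]
  rwa [h5, h4] at h2

theorem hasProd_maximalSpectrum {D : Type*} [CommRing D] [IsDedekindDomain D] (hD : ¬ IsField D)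
    {s : ℂ} (hmul : ∀ I J : Ideal D,
      Nat.card (D ⧸ (I * J)) = Nat.card (D ⧸ I) * Nat.card (D ⧸ J))
    (hsum : Summable fun I : {I : Ideal D // I ≠ ⊥} ↦ ‖normPow s I.1‖) :
    HasProd (fun M : MaximalSpectrum D ↦ (1 - normPow s M.asIdeal)⁻¹)
      (∑' I : {I : Ideal D // I ≠ ⊥}, normPow s I.1) := by
  let χ : Ideal D →* ℂ :=
    { toFun := fun I ↦ normPow s I
      map_one' := by
        have : Nat.card (D ⧸ (1 : Ideal D)) = 1 := by
          rw [Ideal.one_eq_top]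
          exact Nat.card_eq_one_iff_unique.mpr ⟨inferInstance, inferInstance⟩
        rw [normPow, this, Nat.cast_one, Complex.one_cpow]
      map_mul' := fun I J ↦ by
        rw [normPow, hmul, Nat.cast_mul, Complex.natCast_mul_natCast_cpow, normPow, normPow] }
  exact (HeightOneSpectrum.equivMaximalSpectrum hD).hasProd_iff.mp
    (hasProd_inv_one_sub_heightOneSpectrum χ hsum)

/-- Maximal ideals of a domain that is not a field, as nonzero ideals. -/
def maximalToNonzero {D : Type*} [CommRing D] [IsDomain D] (hD : ¬ IsField D)
    (M : MaximalSpectrum D) : {I : Ideal D // I ≠ ⊥} :=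
  ⟨M.asIdeal, Ring.ne_bot_of_isMaximal_of_not_isField M.isMaximal hD⟩

theorem maximalToNonzero_injective {D : Type*} [CommRing D] [IsDomain D] (hD : ¬ IsField D) :
    Function.Injective (maximalToNonzero hD) :=
  fun _ _ h ↦ MaximalSpectrum.ext (congrArg Subtype.val h)

theorem summable_maximalSpectrum {D : Type*} [CommRing D] [IsDomain D] (hD : ¬ IsField D)
    {f : Ideal D → ℝ} (h : Summable fun I : {I : Ideal D // I ≠ ⊥} ↦ f I.1) :
    Summable fun M : MaximalSpectrum D ↦ f M.asIdeal :=
  h.comp_injective (maximalToNonzero_injective hD)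

end Counting

section Dedekind

open NumberField

variable (K : Type*) [Field K] [NumberField K]

theorem LSeriesSummable_card_ideal {s : ℂ} (hs : 1 < s.re) :
    LSeriesSummable (fun n ↦ (Nat.card {I : Ideal (𝓞 K) // Ideal.absNorm I = n} : ℂ)) s := by
  have h := LSeriesSummable_of_sum_norm_bigO_and_nonneg (r := 1) (s := s)
    (f := fun n ↦ (Nat.card {I : Ideal (𝓞 K) // Ideal.absNorm I = n} : ℝ)) ?_
    (fun _ ↦ Nat.cast_nonneg _) zero_le_one hs
  · simpa using h
  have h1 := ((NumberField.Ideal.tendsto_norm_le_div_atTop₀ K).comp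
    tendsto_natCast_atTop_atTop).isBigO_one ℝ
  have h2 := h1.mul (Asymptotics.isBigO_refl (fun n : ℕ ↦ (n : ℝ)) Filter.atTop)
  refine Asymptotics.IsBigO.congr' h2 ?_ (.of_forall fun n ↦ by simp)
  filter_upwards [Filter.eventually_gt_atTop 0] with n hn
  have hn' : (n : ℝ) ≠ 0 := by exact_mod_cast hn.ne'
  simp only [Function.comp_apply, Nat.cast_le]
  rw [div_mul_cancel₀ _ hn', ← Nat.cast_sum]
  congr
  rw [← add_left_inj 1, ← Ideal.card_norm_le_eq_card_norm_le_add_one,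
    show Finset.Icc 1 n = Finset.Ioc 0 n from Finset.Icc_succ_left_eq_Ioc _ _,
    show 1 = Nat.card {I : Ideal (𝓞 K) // Ideal.absNorm I = 0} by simp [Ideal.absNorm_eq_zero_iff],
    Finset.sum_Ioc_add_eq_sum_Icc (n.zero_le),
    ← Finset.card_preimage_eq_sum_card_image_eq
      (fun k _ ↦ Ideal.finite_setOfPred_absNorm_eq k)]
  simp [Set.coe_eq_subtype]

theorem hasSum_normPow_dedekindZeta {s : ℂ} (hs : 1 < s.re) :
    (Summable fun I : {I : Ideal (𝓞 K) // I ≠ ⊥} ↦ ‖normPow s I.1‖) ∧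
      HasSum (fun I : {I : Ideal (𝓞 K) // I ≠ ⊥} ↦ normPow s I.1) (dedekindZeta K s) := by
  let N : {I : Ideal (𝓞 K) // I ≠ ⊥} → ℕ := fun I ↦ Ideal.absNorm I.1
  have hfin : ∀ n, Finite {I // N I = n} := fun n ↦ by
    have := (Ideal.finite_setOfPred_absNorm_eq (S := 𝓞 K) n).to_subtype
    exact Finite.of_injective
      (fun I ↦ (⟨I.1.1, I.2⟩ : {I : Ideal (𝓞 K) | Ideal.absNorm I = n}))
      fun I J h ↦ Subtype.ext (Subtype.ext (by simpa using h))
  have hs0 : s ≠ 0 := by rintro rfl; norm_num at hs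
  have hterm : ∀ n, (Nat.card {I // N I = n} : ℂ) * (n : ℂ) ^ (-s) =
      LSeries.term (fun n ↦ (Nat.card {I : Ideal (𝓞 K) // Ideal.absNorm I = n} : ℂ)) s n := by
    intro n
    rcases eq_or_ne n 0 with rfl | hn
    · simp [hs0]
    rw [LSeries.term_of_ne_zero hn, Complex.cpow_neg, div_eq_mul_inv]
    congr 2
    refine Nat.card_congr ⟨fun I ↦ ⟨I.1.1, I.2⟩, fun I ↦ ⟨⟨I.1, ?_⟩, I.2⟩, fun _ ↦ rfl, fun _ ↦ rfl⟩
    rintro h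
    exact hn (by rw [← I.2, h, Ideal.absNorm_bot])
  have h := LSeriesSummable_card_ideal K hs
  have := hasSum_comp_of_card_fiber N (fun n ↦ (n : ℂ) ^ (-s)) ?_
  · simp_rw [hterm] at this
    exact this
  · refine h.norm.congr fun n ↦ ?_
    rw [← hterm, norm_mul, Complex.norm_natCast]

/-- The Euler product of the Dedekind zeta function. -/
theorem hasProd_dedekindZeta {s : ℂ} (hs : 1 < s.re) :
    HasProd (fun M : MaximalSpectrum (𝓞 K) ↦ (1 - normPow s M.asIdeal)⁻¹) (dedekindZeta K s) := by
  rw [← (hasSum_normPow_dedekindZeta K hs).2.tsum_eq]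
  refine hasProd_maximalSpectrum (RingOfIntegers.not_isField K) (fun I J ↦ ?_)
    (hasSum_normPow_dedekindZeta K hs).1
  exact map_mul Ideal.absNorm I J

theorem summable_normPow_maximalSpectrum {s : ℂ} (hs : 1 < s.re) :
    Summable fun M : MaximalSpectrum (𝓞 K) ↦ ‖normPow s M.asIdeal‖ :=
  summable_maximalSpectrum (RingOfIntegers.not_isField K) (f := fun I ↦ ‖normPow s I‖)
    (hasSum_normPow_dedekindZeta K hs).1

theorem dedekindZeta_ne_zero {s : ℂ} (hs : 1 < s.re) : dedekindZeta K s ≠ 0 := by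
  have h1 := hasProd_dedekindZeta K hs
  have h2 : Multipliable fun M : MaximalSpectrum (𝓞 K) ↦ 1 - normPow s M.asIdeal := by
    simp_rw [sub_eq_add_neg]
    refine multipliable_one_add_of_summable ?_
    simpa only [norm_neg] using summable_normPow_maximalSpectrum K hs
  have h3 := h1.mul h2.hasProd
  have h4 : ∀ M : MaximalSpectrum (𝓞 K),
      (1 - normPow s M.asIdeal)⁻¹ * (1 - normPow s M.asIdeal) = 1 := fun M ↦ by
    have := M.isMaximal
    refine inv_mul_cancel₀ fun h ↦ ?_
    have h5 := norm_normPow_le hs M.asIdeal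
    rw [← sub_eq_zero.mp h, norm_one] at h5
    norm_num at h5
  simp_rw [h4] at h3
  exact left_ne_zero_of_mul_eq_one (h3.unique hasProd_one)

end Dedekind

section FiniteField

open Polynomial

variable (k : Type*) [Field k]

/-- Nonzero ideals of `k[X]` are generated by unique monic polynomials. -/
noncomputable def monicEquivIdeal : {f : k[X] // f.Monic} ≃ {I : Ideal k[X] // I ≠ ⊥} :=
  Equiv.ofBijective
    (fun f ↦ ⟨Ideal.span {f.1}, by simpa using f.2.ne_zero⟩) <| by
    classical
    constructor
    · rintro ⟨f, hf⟩ ⟨g, hg⟩ h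
      have h := Ideal.span_singleton_eq_span_singleton.mp (Subtype.ext_iff.mp h)
      exact Subtype.ext (eq_of_monic_of_associated hf hg h)
    · rintro ⟨I, hI⟩
      obtain ⟨g, rfl⟩ := IsPrincipalIdealRing.principal I
      have hg : g ≠ 0 := by rintro rfl; simp at hI
      exact ⟨⟨normalize g, monic_normalize hg⟩, Subtype.ext
        (Ideal.span_singleton_eq_span_singleton.mpr (normalize_associated g))⟩

theorem card_quotient_span {f : k[X]} (hf : f ≠ 0) :
    Nat.card (k[X] ⧸ Ideal.span {f}) = Nat.card k ^ f.natDegree := by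
  have : Module.Finite k (k[X] ⧸ Ideal.span {f}) := (AdjoinRoot.powerBasis hf).finite
  rw [Module.natCard_eq_pow_finrank (K := k), finrank_quotient_span_eq_natDegree]

theorem card_quotient_mul (I J : Ideal k[X]) :
    Nat.card (k[X] ⧸ (I * J)) = Nat.card (k[X] ⧸ I) * Nat.card (k[X] ⧸ J) := by
  have hbot : Nat.card (k[X] ⧸ (⊥ : Ideal k[X])) = 0 := by
    rw [Nat.card_congr (RingEquiv.quotientBot k[X]).toEquiv]
    exact Nat.card_eq_zero_of_infinite
  obtain ⟨f, rfl⟩ := IsPrincipalIdealRing.principal I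
  obtain ⟨g, rfl⟩ := IsPrincipalIdealRing.principal J
  simp only [Ideal.submodule_span_eq, Ideal.span_singleton_mul_span_singleton]
  rcases eq_or_ne f 0 with rfl | hf
  · simp
  rcases eq_or_ne g 0 with rfl | hg
  · simp
  rw [card_quotient_span k hf, card_quotient_span k hg, card_quotient_span k (mul_ne_zero hf hg),
    natDegree_mul hf hg, pow_add]

variable [Finite k]

/-- The zeta function of the affine line over a finite field, as a sum over ideals. -/
theorem hasSum_normPow_polynomial {s : ℂ} (hs : 1 < s.re) :
    (Summable fun I : {I : Ideal k[X] // I ≠ ⊥} ↦ ‖normPow s I.1‖) ∧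
      HasSum (fun I : {I : Ideal k[X] // I ≠ ⊥} ↦ normPow s I.1)
        (1 - (Nat.card k : ℂ) ^ (-(s - 1)))⁻¹ := by
  let N : {f : k[X] // f.Monic} → ℕ := fun f ↦ f.1.natDegree
  let e (n : ℕ) : {f // N f = n} ≃ (Fin n → k) :=
    (Equiv.subtypeSubtypeEquivSubtypeInter _ _).trans
      ((monicEquivDegreeLT n).trans (degreeLTEquiv k n).toEquiv)
  have hfin : ∀ n, Finite {f // N f = n} := fun n ↦ Finite.of_equiv _ (e n).symm
  have hcard : ∀ n, Nat.card {f // N f = n} = Nat.card k ^ n := fun n ↦ by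
    rw [Nat.card_congr (e n), Nat.card_fun, Nat.card_fin]
  have hk : (Nat.card k : ℂ) ≠ 0 := by exact_mod_cast Nat.card_pos.ne'
  have hterm : ∀ n, (Nat.card {f // N f = n} : ℂ) * ((Nat.card k ^ n : ℕ) : ℂ) ^ (-s) =
      ((Nat.card k : ℂ) ^ (-(s - 1))) ^ n := by
    intro n
    rw [hcard, Nat.cast_pow, neg_sub, sub_eq_add_neg, Complex.cpow_add _ _ hk, Complex.cpow_one,
      mul_pow, ← Complex.natCast_cpow_natCast_mul, ← Complex.cpow_nat_mul, mul_comm (n : ℂ)]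
  have hnorm : ‖(Nat.card k : ℂ) ^ (-(s - 1))‖ < 1 := by
    rw [Complex.norm_natCast_cpow_of_pos Nat.card_pos]
    refine Real.rpow_lt_one_of_one_lt_of_neg (by exact_mod_cast Finite.one_lt_card) ?_
    simp only [Complex.neg_re, Complex.sub_re, Complex.one_re]
    linarith
  have h := hasSum_comp_of_card_fiber N (fun n ↦ ((Nat.card k ^ n : ℕ) : ℂ) ^ (-s)) ?_
  · simp_rw [hterm, tsum_geometric_of_norm_lt_one hnorm] at h
    have key : ∀ f, normPow s (monicEquivIdeal k f).1 = ((Nat.card k ^ N f : ℕ) : ℂ) ^ (-s) := by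
      intro f
      rw [← card_quotient_span k f.2.ne_zero]
      rfl
    rw [← (monicEquivIdeal k).summable_iff, ← (monicEquivIdeal k).hasSum_iff]
    simp only [Function.comp_def, key]
    exact h
  · refine (summable_geometric_of_lt_one (norm_nonneg _) hnorm).congr fun n ↦ ?_
    rw [← norm_pow, ← hterm, norm_mul, Complex.norm_natCast]

theorem hasProd_polynomial {s : ℂ} (hs : 1 < s.re) :
    HasProd (fun M : MaximalSpectrum k[X] ↦ (1 - normPow s M.asIdeal)⁻¹)
      (1 - (Nat.card k : ℂ) ^ (-(s - 1)))⁻¹ := by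
  rw [← (hasSum_normPow_polynomial k hs).2.tsum_eq]
  exact hasProd_maximalSpectrum (Polynomial.not_isField k) (card_quotient_mul k)
    (hasSum_normPow_polynomial k hs).1

/-- The closed points of the affine line over a field with `q` elements contribute at most
`2 q ^ (1 - σ)` to the sum of the `N(x) ^ (-σ)`. -/
theorem tsum_normPow_polynomial_le {s : ℂ} (hs : 2 < s.re) :
    (Summable fun M : MaximalSpectrum k[X] ↦ ‖normPow s M.asIdeal‖) ∧
      ∑' M : MaximalSpectrum k[X], ‖normPow s M.asIdeal‖ ≤
        2 * (Nat.card k : ℝ) ^ (-(s.re - 1)) := by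
  classical
  obtain ⟨h1, -⟩ := hasSum_normPow_polynomial k (s := s) (by linarith)
  -- the sum of the norms is the sum for the real number `σ = re s`
  have h2 : ∑' I : {I : Ideal k[X] // I ≠ ⊥}, ‖normPow s I.1‖ =
      (1 - (Nat.card k : ℝ) ^ (-(s.re - 1)))⁻¹ := by
    obtain ⟨-, h3⟩ := hasSum_normPow_polynomial k (s := (s.re : ℂ)) (by simp; linarith)
    have h4 : ∀ I : Ideal k[X], normPow (s.re : ℂ) I = ((‖normPow s I‖ : ℝ) : ℂ) := by
      intro I
      rw [norm_normPow (by linarith), normPow, Complex.ofReal_cpow (Nat.cast_nonneg _)]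
      push_cast
      rfl
    simp_rw [h4] at h3
    have h5 : (1 - (Nat.card k : ℂ) ^ (-((s.re : ℂ) - 1)))⁻¹ =
        (((1 - (Nat.card k : ℝ) ^ (-(s.re - 1)))⁻¹ : ℝ) : ℂ) := by
      push_cast
      rw [Complex.ofReal_cpow (Nat.cast_nonneg _)]
      push_cast
      rfl
    rw [h5] at h3
    exact (Complex.hasSum_ofReal.mp h3).tsum_eq
  have hi := maximalToNonzero_injective (Polynomial.not_isField k)
  have h6 : Summable fun M : MaximalSpectrum k[X] ↦ ‖normPow s M.asIdeal‖ :=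
    summable_maximalSpectrum (Polynomial.not_isField k) (f := fun I ↦ ‖normPow s I‖) h1
  refine ⟨h6, ?_⟩
  -- split off the contribution of the unit ideal
  let t : {I : Ideal k[X] // I ≠ ⊥} := ⟨⊤, top_ne_bot⟩
  have ht : ‖normPow s t.1‖ = 1 := by
    have : Nat.card (k[X] ⧸ t.1) = 1 :=
      Nat.card_eq_one_iff_unique.mpr
        ⟨Ideal.Quotient.subsingleton_iff.mpr rfl, inferInstance⟩
    rw [normPow, this, Nat.cast_one, Complex.one_cpow, norm_one]
  have h7 := h1.tsum_eq_add_tsum_ite t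
  rw [h2, ht] at h7
  have h8 : ∑' M : MaximalSpectrum k[X], ‖normPow s M.asIdeal‖ ≤
      ∑' I : {I : Ideal k[X] // I ≠ ⊥}, if I = t then 0 else ‖normPow s I.1‖ := by
    refine Summable.tsum_le_tsum_of_inj _ hi (fun c _ ↦ by positivity) (fun M ↦ ?_) h6 ?_
    · have h9 : maximalToNonzero (Polynomial.not_isField k) M ≠ t := fun h ↦
        M.isMaximal.ne_top (congrArg Subtype.val h)
      rw [if_neg h9]
      exact le_rfl
    · refine Summable.of_nonneg_of_le (fun I ↦ by positivity) (fun I ↦ ?_) h1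
      split_ifs
      · exact norm_nonneg _
      · exact le_rfl
  set x := (Nat.card k : ℝ) ^ (-(s.re - 1)) with hx
  have hx0 : 0 ≤ x := by positivity
  have hx2 : x ≤ 1 / 2 := by
    have h9 : (2 : ℝ) ≤ Nat.card k := by exact_mod_cast Finite.one_lt_card
    calc x ≤ (2 : ℝ) ^ (-(s.re - 1)) :=
          Real.rpow_le_rpow_of_nonpos (by norm_num) h9 (by linarith)
      _ ≤ (2 : ℝ) ^ (-1 : ℝ) := Real.rpow_le_rpow_of_exponent_le (by norm_num) (by linarith)
      _ = 1 / 2 := by rw [Real.rpow_neg_one]; norm_num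
  have h10 : (1 - x)⁻¹ ≤ 1 + 2 * x := by
    rw [inv_le_iff_one_le_mul₀ (by linarith)]
    nlinarith
  linarith

end FiniteField

/-! ### The zeta functions of the affine line and of the multiplicative group -/

section AffineLine

open Polynomial

variable {R : Type*} [CommRing R]

/-- The fibres of `Spec R[X]` over the closed points of `Spec R` exhaust the closed points. -/
theorem existsUnique_ker_mapRingHom_le [IsJacobsonRing R] (M : MaximalSpectrum R[X]) :
    ∃! p : MaximalSpectrum R, RingHom.ker (mapRingHom (Ideal.Quotient.mk p.asIdeal)) ≤ M.asIdeal ∧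
      ((1 : ℕ) : R[X]) ∉ M.asIdeal := by
  have := M.isMaximal
  have h1 : ((1 : ℕ) : R[X]) ∉ M.asIdeal := by
    rw [Nat.cast_one]
    exact (Ideal.ne_top_iff_one _).mp M.isMaximal.ne_top
  have hiff : ∀ p : Ideal R, RingHom.ker (mapRingHom (Ideal.Quotient.mk p)) ≤ M.asIdeal ↔
      p ≤ M.asIdeal.comap C := fun p ↦ by
    rw [ker_mapRingHom, Ideal.mk_ker, Ideal.map_le_iff_le_comap]
  have hmax : (M.asIdeal.comap (C : R →+* R[X])).IsMaximal :=
    Polynomial.isMaximal_comap_C_of_isJacobsonRing M.asIdeal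
  refine ⟨⟨_, hmax⟩, ⟨(hiff _).mpr le_rfl, h1⟩, ?_⟩
  rintro p ⟨hp, -⟩
  exact MaximalSpectrum.ext (p.isMaximal.eq_of_le hmax.ne_top ((hiff _).mp hp))

theorem one_notMem_maximalSpectrum {B : Type*} [CommRing B] (q : MaximalSpectrum B) :
    ((1 : ℕ) : B) ∉ q.asIdeal := by
  rw [Nat.cast_one]
  exact (Ideal.ne_top_iff_one _).mp q.isMaximal.ne_top

/-- Removing the divisors of `1` removes nothing. -/
def maximalSpectrumEquivOne (B : Type*) [CommRing B] :
    {q : MaximalSpectrum B // ((1 : ℕ) : B) ∉ q.asIdeal} ≃ MaximalSpectrum B :=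
  Equiv.subtypeUnivEquiv one_notMem_maximalSpectrum

theorem tsum_one_notMem {B : Type*} [CommRing B] {f : MaximalSpectrum B → ℝ} (h : Summable f) :
    (Summable fun q : {q : MaximalSpectrum B // ((1 : ℕ) : B) ∉ q.asIdeal} ↦ f q.1) ∧
      ∑' q : {q : MaximalSpectrum B // ((1 : ℕ) : B) ∉ q.asIdeal}, f q.1 = ∑' q, f q :=
  ⟨(maximalSpectrumEquivOne B).summable_iff.mpr h, (maximalSpectrumEquivOne B).tsum_eq f⟩

theorem norm_normPow_sub_one {I : Ideal R} {s : ℂ} (hs : 2 < s.re) :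
    (Nat.card (R ⧸ I) : ℝ) ^ (-(s.re - 1)) = ‖normPow (s - 1) I‖ := by
  have h : (s - 1).re = s.re - 1 := by simp
  rw [norm_normPow (by rw [h]; linarith), h]

theorem mapRingHom_mk_surjective (p : Ideal R) :
    Function.Surjective (mapRingHom (Ideal.Quotient.mk p)) :=
  map_surjective _ Ideal.Quotient.mk_surjective

variable [IsJacobsonRing R]

/-- The sum of the `N(x)^{-s}` over the closed points of the affine line converges absolutely, since
each fibre over a closed point `p` of `Spec R` contributes at most `2 N(p)^{1-σ}`. -/
theorem summable_normPow_polynomial (hfin : ∀ p : MaximalSpectrum R, Finite (R ⧸ p.asIdeal))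
    {s : ℂ} (hs : 2 < s.re)
    (hsum : Summable fun p : MaximalSpectrum R ↦ ‖normPow (s - 1) p.asIdeal‖) :
    Summable fun M : MaximalSpectrum R[X] ↦ ‖normPow s M.asIdeal‖ := by
  obtain ⟨e, key⟩ : ∃ e : (Σ p : MaximalSpectrum R, {q : MaximalSpectrum (R ⧸ p.asIdeal)[X] //
      ((1 : ℕ) : (R ⧸ p.asIdeal)[X]) ∉ q.asIdeal}) ≃ MaximalSpectrum R[X],
      ∀ x, normPow s (e x).asIdeal = normPow s x.2.1.asIdeal := by
    have hφ : ∀ p : MaximalSpectrum R, (mapRingHom (Ideal.Quotient.mk p.asIdeal)).IsIntegral :=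
      fun p ↦ RingHom.isIntegral_of_surjective _ (mapRingHom_mk_surjective _)
    have hn : ∀ (p : MaximalSpectrum R) b, ∃ a, mapRingHom (Ideal.Quotient.mk p.asIdeal) a =
      ((1 : ℕ) : (R ⧸ p.asIdeal)[X]) * b := fun p b ↦ mapRingHom_mk_surjective _ _
    refine ⟨sigmaEquivMaximalSpectrum (fun p ↦ mapRingHom (Ideal.Quotient.mk p.asIdeal))
      (fun _ ↦ 1) hφ hn existsUnique_ker_mapRingHom_le, ?_⟩
    rintro ⟨p, q, hq⟩
    exact congrArg (fun k : ℕ ↦ (k : ℂ) ^ (-s)) (card_quotient_comap (hφ p) (hn p) q hq)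
  rw [← e.summable_iff]
  simp only [Function.comp_def, key]
  rw [summable_sigma_of_nonneg fun _ ↦ norm_nonneg _]
  have hfib : ∀ p : MaximalSpectrum R,
      (Summable fun q : {q : MaximalSpectrum (R ⧸ p.asIdeal)[X] //
        ((1 : ℕ) : (R ⧸ p.asIdeal)[X]) ∉ q.asIdeal} ↦ ‖normPow s q.1.asIdeal‖) ∧
      ∑' q : {q : MaximalSpectrum (R ⧸ p.asIdeal)[X] //
        ((1 : ℕ) : (R ⧸ p.asIdeal)[X]) ∉ q.asIdeal}, ‖normPow s q.1.asIdeal‖ ≤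
        2 * ‖normPow (s - 1) p.asIdeal‖ := by
    intro p
    have := p.isMaximal
    have := hfin p
    let := Ideal.Quotient.field p.asIdeal
    obtain ⟨h1, h2⟩ := tsum_normPow_polynomial_le (R ⧸ p.asIdeal) hs
    rw [norm_normPow_sub_one hs] at h2
    obtain ⟨h3, h4⟩ := tsum_one_notMem h1
    exact ⟨h3, h4.trans_le h2⟩
  refine ⟨fun p ↦ (hfib p).1, ?_⟩
  exact Summable.of_nonneg_of_le (fun p ↦ tsum_nonneg fun _ ↦ norm_nonneg _)
    (fun p ↦ (hfib p).2) (hsum.mul_left 2)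

/-- The zeta function of the affine line over `R` at `s` is that of `R` at `s - 1`. -/
theorem hasProd_normPow_sub_one (hfin : ∀ p : MaximalSpectrum R, Finite (R ⧸ p.asIdeal))
    {s : ℂ} (hs : 2 < s.re)
    (hsum : Summable fun p : MaximalSpectrum R ↦ ‖normPow (s - 1) p.asIdeal‖) :
    HasProd (fun p : MaximalSpectrum R ↦ (1 - normPow (s - 1) p.asIdeal)⁻¹)
      (∏' M : MaximalSpectrum R[X], (1 - normPow s M.asIdeal)⁻¹) := by
  have h := (hasProd_tprod_normPow
    (fun p : MaximalSpectrum R ↦ mapRingHom (Ideal.Quotient.mk p.asIdeal)) (fun _ ↦ 1)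
    (fun p ↦ RingHom.isIntegral_of_surjective _ (mapRingHom_mk_surjective _))
    (fun p b ↦ mapRingHom_mk_surjective _ _) existsUnique_ker_mapRingHom_le
    (s := s) (by linarith) (summable_normPow_polynomial hfin hs hsum)).2
  convert h using 1
  funext p
  have := p.isMaximal
  have := hfin p
  let := Ideal.Quotient.field p.asIdeal
  have h1 := (hasProd_polynomial (R ⧸ p.asIdeal) (s := s) (by linarith)).tprod_eq
  rw [normPow, ← h1]
  exact ((maximalSpectrumEquivOne (R ⧸ p.asIdeal)[X]).tprod_eq
    (fun M : MaximalSpectrum (R ⧸ p.asIdeal)[X] ↦ (1 - normPow s M.asIdeal)⁻¹)).symm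

end AffineLine

section MultiplicativeGroup

open Polynomial

variable {R : Type*} [CommRing R]

/-- The closed points of the multiplicative group are the closed points of the affine line away
from the origin. -/
noncomputable def laurentMaximalEquiv [IsJacobsonRing R] :
    MaximalSpectrum R[T;T⁻¹] ≃ {M : MaximalSpectrum R[X] | X ∉ M.asIdeal} :=
  ((MaximalSpectrum.equivSubtype _).trans
    (IsLocalization.orderIsoOfMaximal (X : R[X]) (S := R[T;T⁻¹])).toEquiv).trans
    ⟨fun M ↦ ⟨⟨M.1, M.2.1⟩, M.2.2⟩, fun M ↦ ⟨M.1.asIdeal, M.1.isMaximal, M.2⟩,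
      fun _ ↦ rfl, fun _ ↦ rfl⟩

theorem card_quotient_laurentMaximalEquiv [IsJacobsonRing R] (M : MaximalSpectrum R[T;T⁻¹]) :
    Nat.card (R[X] ⧸ (laurentMaximalEquiv M).1.asIdeal) = Nat.card (R[T;T⁻¹] ⧸ M.asIdeal) := by
  set I := (laurentMaximalEquiv M).1.asIdeal with hI
  have hI' : I = M.asIdeal.comap toLaurent := rfl
  have hX : (X : R[X]) ∉ I := (laurentMaximalEquiv M).2
  have := (laurentMaximalEquiv M).1.isMaximal
  refine Nat.card_congr (Equiv.ofBijective (Ideal.quotientMap M.asIdeal toLaurent hI'.le)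
    ⟨Ideal.quotientMap_injective' (by rw [hI']), fun b ↦ ?_⟩)
  obtain ⟨a, rfl⟩ := Ideal.Quotient.mk_surjective b
  obtain ⟨n, p, hp⟩ := a.exists_T_pow
  -- `X` is invertible modulo `I`
  have hXn : (X ^ n : R[X]) ∉ I := fun h ↦ hX (this.isPrime.mem_of_pow_mem _ h)
  obtain ⟨c, m, hm, hc⟩ := this.exists_inv hXn
  refine ⟨Ideal.Quotient.mk _ (p * c), ?_⟩
  rw [Ideal.quotientMap_mk, Ideal.Quotient.eq, map_mul, hp]
  have h1 := congrArg toLaurent hc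
  rw [map_add, map_mul, toLaurent_X_pow, map_one] at h1
  have h2 : a * LaurentPolynomial.T n * toLaurent c - a = -(a * toLaurent m) := by
    linear_combination a * h1
  rw [h2]
  exact M.asIdeal.neg_mem (M.asIdeal.mul_mem_left _ hm)

/-- The closed points of the affine line over `R` at the origin are the closed points of `R`. -/
noncomputable def originMaximalEquiv :
    MaximalSpectrum R ≃ {M : MaximalSpectrum R[X] | X ∈ M.asIdeal} :=
  (maximalSpectrumEquivOne R).symm.trans
    ((maximalSpectrumEquivOfIsIntegral (constantCoeff : R[X] →+* R) 1
      (RingHom.isIntegral_of_surjective _ fun r ↦ ⟨C r, by simp⟩) fun b ↦ ⟨C b, by simp⟩).trans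
      (Equiv.subtypeEquivRight fun M ↦ by
        have : RingHom.ker (constantCoeff : R[X] →+* R) = Ideal.span {X} := by
          ext p
          rw [RingHom.mem_ker, Ideal.mem_span_singleton, X_dvd_iff, constantCoeff_apply]
        rw [this, Ideal.span_singleton_le_iff_mem]
        exact and_iff_left (one_notMem_maximalSpectrum M)))

theorem card_quotient_originMaximalEquiv (p : MaximalSpectrum R) :
    Nat.card (R[X] ⧸ (originMaximalEquiv p).1.asIdeal) = Nat.card (R ⧸ p.asIdeal) :=
  card_quotient_comap (n := 1) (φ := (constantCoeff : R[X] →+* R))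
    (RingHom.isIntegral_of_surjective _ fun r ↦ ⟨C r, by simp⟩) (fun b ↦ ⟨C b, by simp⟩) p
    (one_notMem_maximalSpectrum p)

variable [IsJacobsonRing R]

theorem normPow_laurentMaximalEquiv (s : ℂ) (M : MaximalSpectrum R[T;T⁻¹]) :
    normPow s (laurentMaximalEquiv M).1.asIdeal = normPow s M.asIdeal := by
  rw [normPow, card_quotient_laurentMaximalEquiv, normPow]

theorem summable_normPow_laurent (hfin : ∀ p : MaximalSpectrum R, Finite (R ⧸ p.asIdeal))
    {s : ℂ} (hs : 2 < s.re)
    (hsum : Summable fun p : MaximalSpectrum R ↦ ‖normPow (s - 1) p.asIdeal‖) :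
    Summable fun M : MaximalSpectrum R[T;T⁻¹] ↦ ‖normPow s M.asIdeal‖ := by
  have h := (summable_normPow_polynomial hfin hs hsum).comp_injective
    (Subtype.val_injective.comp (laurentMaximalEquiv (R := R)).injective)
  simp only [Function.comp_def] at h
  simpa only [normPow_laurentMaximalEquiv] using h

/-- The affine line is the disjoint union of the multiplicative group and the origin. -/
theorem hasProd_normPow_laurent_mul (hfin : ∀ p : MaximalSpectrum R, Finite (R ⧸ p.asIdeal))
    {s : ℂ} (hs : 2 < s.re)
    (hsum : Summable fun p : MaximalSpectrum R ↦ ‖normPow (s - 1) p.asIdeal‖)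
    {a : ℂ} (ha : HasProd (fun p : MaximalSpectrum R ↦ (1 - normPow s p.asIdeal)⁻¹) a) :
    HasProd (fun p : MaximalSpectrum R ↦ (1 - normPow (s - 1) p.asIdeal)⁻¹)
      ((∏' M : MaximalSpectrum R[T;T⁻¹], (1 - normPow s M.asIdeal)⁻¹) * a) := by
  have h1 := (multipliable_normPow (A := R[T;T⁻¹]) (s := s) (by linarith) (fun M ↦ M)
    (summable_normPow_laurent hfin hs hsum)).hasProd
  have h2 : HasProd ((fun M : MaximalSpectrum R[X] ↦ (1 - normPow s M.asIdeal)⁻¹) ∘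
      (Subtype.val : {M : MaximalSpectrum R[X] | X ∉ M.asIdeal} → _))
      (∏' M : MaximalSpectrum R[T;T⁻¹], (1 - normPow s M.asIdeal)⁻¹) := by
    rw [← laurentMaximalEquiv.hasProd_iff]
    simpa only [Function.comp_def, normPow_laurentMaximalEquiv] using h1
  have h3 : HasProd ((fun M : MaximalSpectrum R[X] ↦ (1 - normPow s M.asIdeal)⁻¹) ∘
      (Subtype.val : {M : MaximalSpectrum R[X] | X ∈ M.asIdeal} → _)) a := by
    rw [← originMaximalEquiv.hasProd_iff]
    have h4 : ∀ p : MaximalSpectrum R,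
        normPow s (originMaximalEquiv p).1.asIdeal = normPow s p.asIdeal := fun p ↦ by
      rw [normPow, card_quotient_originMaximalEquiv, normPow]
    simpa only [Function.comp_def, h4] using ha
  have hc : IsCompl {M : MaximalSpectrum R[X] | X ∉ M.asIdeal} {M | X ∈ M.asIdeal} := by
    rw [← Set.compl_ofPred]
    exact isCompl_compl.symm
  rw [← (HasProd.mul_isCompl hc h2 h3).tprod_eq]
  exact hasProd_normPow_sub_one hfin hs hsum

end MultiplicativeGroup

/-! ### Closed points of the multiplicative group over rings of integers -/

section Finiteness

open Polynomial

theorem isJacobsonRing_int : IsJacobsonRing ℤ := by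
  rw [isJacobsonRing_iff_prime_eq]
  intro P hP
  by_cases h : P = ⊥
  · subst h
    refine le_antisymm (fun x hx ↦ ?_) Ideal.le_jacobson
    rw [Ideal.mem_bot]
    by_contra hx0
    -- a prime exceeding `|x|` does not divide `x`
    obtain ⟨p, hp, hpp⟩ := Nat.exists_infinite_primes (x.natAbs + 1)
    have hmax : (Ideal.span {(p : ℤ)}).IsMaximal :=
      PrincipalIdealRing.isMaximal_of_irreducible (Nat.prime_iff_prime_int.mp hpp).irreducible
    have h1 : x ∈ Ideal.span {(p : ℤ)} := (Ideal.mem_sInf.mp hx) ⟨bot_le, hmax⟩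
    rw [Ideal.mem_span_singleton, Int.natCast_dvd] at h1
    have := Nat.le_of_dvd (Int.natAbs_pos.mpr hx0) h1
    omega
  · have := hP.isMaximal h
    exact Ideal.jacobson_eq_self_of_isMaximal

theorem isJacobsonRing_ringOfIntegers (K : Type*) [Field K] [NumberField K] :
    IsJacobsonRing (NumberField.RingOfIntegers K) :=
  have := isJacobsonRing_int
  isJacobsonRing_of_isIntegral (R := ℤ)

theorem finite_quotient_ringOfIntegers (K : Type*) [Field K] [NumberField K]
    (p : MaximalSpectrum (NumberField.RingOfIntegers K)) :
    Finite (NumberField.RingOfIntegers K ⧸ p.asIdeal) :=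
  Ideal.finiteQuotientOfFreeOfNeBot _
    (Ring.ne_bot_of_isMaximal_of_not_isField p.isMaximal (NumberField.RingOfIntegers.not_isField K))

theorem finite_quotient_int (p : MaximalSpectrum ℤ) : Finite (ℤ ⧸ p.asIdeal) :=
  Ideal.finiteQuotientOfFreeOfNeBot _
    (Ring.ne_bot_of_isMaximal_of_not_isField p.isMaximal Int.not_isField)

/-- Algebras of finite type over a Jacobson ring with finite residue fields have finite residue
fields. -/
theorem finite_quotient_of_finiteType {R A : Type*} [CommRing R] [IsJacobsonRing R] [CommRing A]
    [Algebra R A] [Algebra.FiniteType R A]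
    (hfin : ∀ p : MaximalSpectrum R, Finite (R ⧸ p.asIdeal)) (M : MaximalSpectrum A) :
    Finite (A ⧸ M.asIdeal) := by
  have := M.isMaximal
  let := Ideal.Quotient.field M.asIdeal
  have : Algebra.FiniteType R (A ⧸ M.asIdeal) :=
    .of_surjective (Ideal.Quotient.mkₐ R M.asIdeal) Ideal.Quotient.mk_surjective
  have h1 : Module.Finite R (A ⧸ M.asIdeal) := finite_of_finite_type_of_isJacobsonRing _ _
  have hmax : (M.asIdeal.comap (algebraMap R A)).IsMaximal := by
    have hbot : (⊥ : Ideal (A ⧸ M.asIdeal)).IsMaximal := Ideal.bot_isMaximal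
    have h2 := Ideal.isMaximal_comap_of_isIntegral_of_isMaximal' (algebraMap R (A ⧸ M.asIdeal))
      (algebraMap_isIntegral_iff.mpr inferInstance) ⊥
    rwa [IsScalarTower.algebraMap_eq R A (A ⧸ M.asIdeal), ← Ideal.comap_comap,
      Ideal.Quotient.algebraMap_eq, ← RingHom.ker_eq_comap_bot, Ideal.mk_ker] at h2
  have : Finite (R ⧸ M.asIdeal.comap (algebraMap R A)) := hfin ⟨_, hmax⟩
  have : Module.Finite (R ⧸ M.asIdeal.comap (algebraMap R A)) (A ⧸ M.asIdeal) :=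
    Module.Finite.of_restrictScalars_finite R _ _
  exact Module.finite_of_finite (R ⧸ M.asIdeal.comap (algebraMap R A))

/-- Every closed point of the multiplicative group with finite residue field lies on `μ_n` for some
`n` prime to the residue characteristic. -/
theorem exists_T_sub_one_mem {R : Type*} [CommRing R] (M : MaximalSpectrum R[T;T⁻¹])
    [Finite (R[T;T⁻¹] ⧸ M.asIdeal)] :
    ∃ n : ℕ, 0 < n ∧ (n : R[T;T⁻¹]) ∉ M.asIdeal ∧
      LaurentPolynomial.T (n : ℤ) - 1 ∈ M.asIdeal := by
  have := M.isMaximal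
  let := Ideal.Quotient.field M.asIdeal
  let := Fintype.ofFinite (R[T;T⁻¹] ⧸ M.asIdeal)
  have hc : 1 < Fintype.card (R[T;T⁻¹] ⧸ M.asIdeal) := Fintype.one_lt_card
  -- the order of the multiplicative group of the residue field is `-1` in that field
  refine ⟨Fintype.card (R[T;T⁻¹] ⧸ M.asIdeal) - 1, by omega, ?_, ?_⟩
  · rw [← Ideal.Quotient.eq_zero_iff_mem, map_natCast, Nat.cast_sub hc.le,
      FiniteField.cast_card_eq_zero]
    simp
  · rw [← Ideal.Quotient.eq_zero_iff_mem, map_sub, map_one, sub_eq_zero]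
    have hu := (LaurentPolynomial.isUnit_T (R := R) 1).map (Ideal.Quotient.mk M.asIdeal)
    rw [← mul_one ((_ : ℕ) : ℤ), ← LaurentPolynomial.T_pow, map_pow]
    exact FiniteField.pow_card_sub_one_eq_one _ hu.ne_zero

end Finiteness

section Integers

open Polynomial NumberField

theorem isCyclotomicExtension_cyclotomicField (n : ℕ+) :
    IsCyclotomicExtension {(n : ℕ)} ℚ (CyclotomicField n ℚ) :=
  have : NeZero ((n : ℕ) : ℚ) := ⟨by exact_mod_cast n.ne_zero⟩
  CyclotomicField.isCyclotomicExtension (n : ℕ) ℚ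

variable (n : ℕ+)

theorem exists_unit_isPrimitiveRoot :
    ∃ u : (𝓞 (CyclotomicField n ℚ))ˣ, IsPrimitiveRoot (u : 𝓞 (CyclotomicField n ℚ)) n := by
  have := isCyclotomicExtension_cyclotomicField n
  have hζ := IsCyclotomicExtension.zeta_spec n ℚ (CyclotomicField n ℚ)
  have h1 := hζ.toInteger_isPrimitiveRoot
  exact ⟨h1.isUnit n.ne_zero |>.unit, h1⟩

/-- The homomorphism `T ↦ ζ_n` to the ring of integers of the `n`-th cyclotomic field. -/
noncomputable def cyclotomicEval : ℤ[T;T⁻¹] →+* 𝓞 (CyclotomicField n ℚ) :=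
  laurentEval (exists_unit_isPrimitiveRoot n).choose

theorem cyclotomicEval_isIntegral : (cyclotomicEval n).IsIntegral :=
  laurentEval_isIntegral _

theorem exists_cyclotomicEval_eq (b : 𝓞 (CyclotomicField n ℚ)) :
    ∃ a, cyclotomicEval n a = (n : ℕ) * b := by
  have := isCyclotomicExtension_cyclotomicField n
  have hu := (exists_unit_isPrimitiveRoot n).choose_spec
  refine range_laurentEval_of_mem_adjoin _ ?_
  refine natCast_mul_mem_adjoin ℚ (L := CyclotomicField n ℚ) ?_ hu.pow_eq_one n.pos b
  exact IsCyclotomicExtension.adjoin_primitive_root_eq_top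
    (hu.map_of_injective (f := algebraMap (𝓞 (CyclotomicField n ℚ)) (CyclotomicField n ℚ))
      RingOfIntegers.coe_injective)

theorem ker_cyclotomicEval_le_iff (I : Ideal ℤ[T;T⁻¹]) :
    RingHom.ker (cyclotomicEval n) ≤ I ↔ toLaurent (cyclotomic n ℤ) ∈ I := by
  have hu := (exists_unit_isPrimitiveRoot n).choose_spec
  have h1 := cyclotomic_eq_minpoly
    (hu.map_of_injective (f := algebraMap (𝓞 (CyclotomicField n ℚ)) (CyclotomicField n ℚ))
      RingOfIntegers.coe_injective) n.pos
  rw [minpoly.algebraMap_eq RingOfIntegers.coe_injective] at h1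
  rw [h1]
  exact ker_laurentEval_le_iff _ (Algebra.IsIntegral.isIntegral _) I

/-- The closed points of the multiplicative group over the integers are the disjoint union of those
of the rings `ℤ[1/n, ζ_n]`. -/
theorem existsUnique_ker_cyclotomicEval_le (M : MaximalSpectrum ℤ[T;T⁻¹]) :
    ∃! n : ℕ+, RingHom.ker (cyclotomicEval n) ≤ M.asIdeal ∧
      ((n : ℕ) : ℤ[T;T⁻¹]) ∉ M.asIdeal := by
  have := isJacobsonRing_int
  have := finite_quotient_of_finiteType finite_quotient_int M
  have hM := M.isMaximal.isPrime
  simp only [ker_cyclotomicEval_le_iff]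
  obtain ⟨n, hn, hnM, hTM⟩ := exists_T_sub_one_mem M
  rw [← toLaurent_X_pow_sub_one, ← prod_cyclotomic_eq_X_pow_sub_one hn, map_prod,
    hM.prod_mem_iff] at hTM
  obtain ⟨d, hd, hdM⟩ := hTM
  have hdn := Nat.dvd_of_mem_divisors hd
  refine ⟨⟨d, Nat.pos_of_mem_divisors hd⟩, ⟨hdM, fun h ↦ hnM ?_⟩, ?_⟩
  · obtain ⟨e, rfl⟩ := hdn
    rw [Nat.cast_mul]
    exact M.asIdeal.mul_mem_right _ h
  · rintro m ⟨hm, hmM⟩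
    have hd0 : ((d : ℕ) : ℤ[T;T⁻¹]) ∉ M.asIdeal := fun h ↦ hnM <| by
      obtain ⟨e, rfl⟩ := hdn
      rw [Nat.cast_mul]
      exact M.asIdeal.mul_mem_right _ h
    have hdvd : ∀ {k l : ℕ}, 0 < l → k ∣ l → cyclotomic k ℤ ∣ X ^ l - 1 := fun {k l} hl hkl ↦ by
      rw [← prod_cyclotomic_eq_X_pow_sub_one hl]
      exact Finset.dvd_prod_of_mem _ (Nat.mem_divisors.mpr ⟨hkl, hl.ne'⟩)
    have hd' := Nat.pos_of_mem_divisors hd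
    have hmd : 0 < (m : ℕ) * d := Nat.mul_pos m.pos hd'
    refine PNat.eq (cyclotomic_injective (R := ℤ) (eq_of_dvd_X_pow_sub_one (cyclotomic.monic _ ℤ)
      (cyclotomic.monic _ ℤ) (cyclotomic.irreducible m.pos) (cyclotomic.irreducible hd')
      (hdvd hmd (dvd_mul_right _ _)) (hdvd hmd (dvd_mul_left _ _)) M.asIdeal hm hdM ?_))
    rw [Nat.cast_mul]
    exact fun h ↦ (hM.mem_or_mem h).elim hmM hd0

end Integers

/-! ### Points of the multiplicative group -/

section Points

variable {R : Type u} [CommRing R]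

/-- The prime ideal of Laurent polynomials corresponding to a point of `𝔾_m`. -/
def pointIdeal (P : Gm R) : Ideal R[T;T⁻¹] :=
  PrimeSpectrum.asIdeal (R := R[T;T⁻¹]) P

instance (P : Gm R) : (pointIdeal P).IsPrime :=
  PrimeSpectrum.isPrime (R := R[T;T⁻¹]) P

theorem pointIdeal_injective : Function.Injective (pointIdeal (R := R)) :=
  fun _ _ h ↦ PrimeSpectrum.ext h

theorem mem_closedPoints_iff_isMaximal (P : Gm R) :
    P ∈ closedPoints (Gm R) ↔ (pointIdeal P).IsMaximal :=
  PrimeSpectrum.isClosed_singleton_iff_isMaximal (R := R[T;T⁻¹]) P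

theorem mem_range_muIncl_iff (n : ℕ) (P : Gm R) :
    P ∈ Set.range (muIncl R n) ↔ LaurentPolynomial.T (n : ℤ) - 1 ∈ pointIdeal P := by
  have h : Set.range (muIncl R n) = PrimeSpectrum.zeroLocus
      (R := R[T;T⁻¹]) {(LaurentPolynomial.T (n : ℤ) - 1 : R[T;T⁻¹])} := by
    have h1 := range_comap_of_surjective _ (Ideal.Quotient.mk
      (Ideal.span {(LaurentPolynomial.T (n : ℤ) - 1 : R[T;T⁻¹])})) Ideal.Quotient.mk_surjective
    rw [Ideal.mk_ker, PrimeSpectrum.zeroLocus_span] at h1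
    exact h1
  rw [h]
  exact Set.singleton_subset_iff

/-- The order of a torsion point is the order of the class of `T`. -/
theorem pointOrder_eq_orderOf (P : Gm R) (hP : IsTorsionPoint R P) :
    pointOrder R P = orderOf (Ideal.Quotient.mk (pointIdeal P) (LaurentPolynomial.T 1)) ∧
      0 < pointOrder R P := by
  have hset : {n : ℕ | 0 < n ∧ P ∈ Set.range (muIncl R n)} =
      {n : ℕ | 0 < n ∧ Ideal.Quotient.mk (pointIdeal P) (LaurentPolynomial.T 1) ^ n = 1} := by
    ext n
    refine and_congr_right fun _ ↦ ?_
    rw [mem_range_muIncl_iff, ← map_pow, LaurentPolynomial.T_pow, mul_one,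
      ← map_one (Ideal.Quotient.mk _), Ideal.Quotient.eq]
  have hne : {n : ℕ | 0 < n ∧ P ∈ Set.range (muIncl R n)}.Nonempty := hP
  have hmem := Nat.sInf_mem hne
  rw [pointOrder]
  rw [hset] at hmem ⊢
  refine ⟨le_antisymm (Nat.sInf_le ⟨?_, pow_orderOf_eq_one _⟩)
    (orderOf_le_of_pow_eq_one hmem.1 hmem.2), hmem.1⟩
  exact orderOf_pos_iff.mpr (isOfFinOrder_iff_pow_eq_one.mpr ⟨_, hmem.1, hmem.2⟩)

theorem pointOrder_pos {P : Gm R} (hP : IsTorsionPoint R P) : 0 < pointOrder R P :=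
  (pointOrder_eq_orderOf P hP).2

theorem T_pointOrder_sub_one_mem {P : Gm R} (hP : IsTorsionPoint R P) :
    LaurentPolynomial.T (pointOrder R P : ℤ) - 1 ∈ pointIdeal P :=
  (mem_range_muIncl_iff _ _).mp (Nat.sInf_mem (s := {n : ℕ | 0 < n ∧ P ∈ Set.range (muIncl R n)})
    hP).2

theorem pointOrder_dvd {P : Gm R} (hP : IsTorsionPoint R P) {n : ℕ}
    (hn : LaurentPolynomial.T (n : ℤ) - 1 ∈ pointIdeal P) : pointOrder R P ∣ n := by
  rw [(pointOrder_eq_orderOf P hP).1, orderOf_dvd_iff_pow_eq_one, ← map_pow,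
    LaurentPolynomial.T_pow, mul_one, ← map_one (Ideal.Quotient.mk _), Ideal.Quotient.eq]
  exact hn

/-- The residue field of a closed point is the quotient by the corresponding maximal ideal. -/
theorem exists_surjective_residueField {P : Gm R} (hP : P ∈ closedPoints (Gm R)) :
    ∃ ev : R[T;T⁻¹] →+* (Gm R).residueField P,
      Function.Surjective ev ∧ RingHom.ker ev = pointIdeal P := by
  have hmax := (mem_closedPoints_iff_isMaximal P).mp hP
  let e := (Scheme.Spec.residueFieldIso (.of R[T;T⁻¹]) P).symm.commRingCatIsoToRingEquiv
  have : (PrimeSpectrum.asIdeal (R := R[T;T⁻¹]) P).IsMaximal := hmax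
  refine ⟨e.toRingHom.comp
    (algebraMap R[T;T⁻¹] (PrimeSpectrum.asIdeal (R := R[T;T⁻¹]) P).ResidueField), ?_, ?_⟩
  · exact e.surjective.comp (Ideal.algebraMap_residueField_surjective _)
  · exact (RingHom.ker_comp_of_injective _ e.injective).trans
      (Ideal.ker_algebraMap_residueField _)

theorem card_residueField {P : Gm R} (hP : P ∈ closedPoints (Gm R)) :
    Nat.card ((Gm R).residueField P) = Nat.card (R[T;T⁻¹] ⧸ pointIdeal P) := by
  obtain ⟨ev, hev, hker⟩ := exists_surjective_residueField hP
  rw [← hker]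
  exact Nat.card_congr (RingHom.quotientKerEquivOfSurjective hev).symm.toEquiv

variable (R) in
/-- The closed points of `𝔾_m` are the maximal ideals of the ring of Laurent polynomials. -/
noncomputable def closedPointsEquiv : closedPoints (Gm R) ≃ MaximalSpectrum R[T;T⁻¹] where
  toFun P := ⟨pointIdeal P.1, (mem_closedPoints_iff_isMaximal P.1).mp P.2⟩
  invFun M := ⟨M.toPrimeSpectrum, (mem_closedPoints_iff_isMaximal _).mpr M.isMaximal⟩
  left_inv _ := rfl
  right_inv _ := rfl

theorem eulerFactor_eq (s : ℂ) (P : closedPoints (Gm R)) :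
    eulerFactor (Gm R) s P = (1 - normPow s (closedPointsEquiv R P).asIdeal)⁻¹ := by
  rw [eulerFactor, card_residueField P.2, normPow]
  rfl

theorem multipliable_eulerFactor_iff (s : ℂ) : Multipliable (eulerFactor (Gm R) s) ↔
    Multipliable fun M : MaximalSpectrum R[T;T⁻¹] ↦ (1 - normPow s M.asIdeal)⁻¹ := by
  rw [← (closedPointsEquiv R).multipliable_iff, funext (eulerFactor_eq (R := R) s)]
  rfl

theorem hasseWeilZeta_eq (s : ℂ) : hasseWeilZeta (Gm R) s =
    ∏' M : MaximalSpectrum R[T;T⁻¹], (1 - normPow s M.asIdeal)⁻¹ := by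
  rw [hasseWeilZeta, ← (closedPointsEquiv R).tprod_eq]
  exact tprod_congr (eulerFactor_eq s)

end Points

/-! ### Modified Dedekind zeta functions as Euler products over maximal ideals -/

section Modified

open NumberField IsDedekindDomain

variable (F : Type u) [Field F] [NumberField F] (n : ℕ)

/-- The primes of a number field not dividing `n`, as maximal ideals. -/
noncomputable def heightOneEquiv :
    {q : HeightOneSpectrum (𝓞 F) // (n : 𝓞 F) ∉ q.asIdeal} ≃
      {q : MaximalSpectrum (𝓞 F) // (n : 𝓞 F) ∉ q.asIdeal} :=
  (HeightOneSpectrum.equivMaximalSpectrum (RingOfIntegers.not_isField F)).subtypeEquiv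
    fun _ ↦ Iff.rfl

theorem multipliable_modifiedDedekindFactor_iff (s : ℂ) :
    Multipliable (modifiedDedekindFactor F n s) ↔
      Multipliable fun q : {q : MaximalSpectrum (𝓞 F) // (n : 𝓞 F) ∉ q.asIdeal} ↦
        (1 - normPow s q.1.asIdeal)⁻¹ :=
  (heightOneEquiv F n).multipliable_iff
    (f := fun q : {q : MaximalSpectrum (𝓞 F) // (n : 𝓞 F) ∉ q.asIdeal} ↦
      (1 - normPow s q.1.asIdeal)⁻¹)

theorem modifiedDedekindZeta_eq (s : ℂ) : modifiedDedekindZeta F n s =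
    ∏' q : {q : MaximalSpectrum (𝓞 F) // (n : 𝓞 F) ∉ q.asIdeal},
      (1 - normPow s q.1.asIdeal)⁻¹ :=
  (heightOneEquiv F n).tprod_eq
    (fun q : {q : MaximalSpectrum (𝓞 F) // (n : 𝓞 F) ∉ q.asIdeal} ↦
      (1 - normPow s q.1.asIdeal)⁻¹)

end Modified

/-! ### The residue fields of the closed torsion points -/

section TorsionPoints

open Polynomial NumberField

variable {K : Type u} [Field K]

/-- A field generated over a number field by a root of unity is a number field. -/
theorem numberField_of_laurentEval [NumberField K] {L : Type*} [Field L] [Algebra K L] (u : Lˣ)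
    (hu : Function.Surjective (laurentEval (R := K) u)) {n : ℕ} (hn : 0 < n)
    (hun : (u : L) ^ n = 1) :
    NumberField L ∧ FiniteDimensional K L ∧ Algebra.adjoin K {(u : L)} = ⊤ := by
  have hint : IsIntegral K (u : L) := ⟨X ^ n - 1, monic_X_pow_sub_C 1 hn.ne', by simp [hun]⟩
  have hinv : ((u⁻¹ : Lˣ) : L) ∈ Algebra.adjoin K {(u : L)} := by
    have : ((u⁻¹ : Lˣ) : L) = (u : L) ^ (n - 1) := by
      rw [← mul_right_inj' u.ne_zero, Units.mul_inv, mul_pow_sub_one hn.ne', hun]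
    rw [this]
    exact pow_mem (Algebra.self_mem_adjoin_singleton K _) _
  have htop : Algebra.adjoin K {(u : L)} = ⊤ := by
    rw [eq_top_iff]
    rintro b -
    obtain ⟨a, rfl⟩ := hu b
    induction a using LaurentPolynomial.induction_on' with
    | add p q hp hq => rw [map_add]; exact add_mem hp hq
    | C_mul_T k r =>
      rw [LaurentPolynomial.eval₂_C_mul_T]
      refine mul_mem (Subalgebra.algebraMap_mem _ _) ?_
      obtain ⟨k, rfl | rfl⟩ := k.eq_nat_or_neg
      · rw [zpow_natCast, Units.val_pow_eq_pow_val]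
        exact pow_mem (Algebra.self_mem_adjoin_singleton K _) _
      · rw [zpow_neg, ← inv_zpow, zpow_natCast, Units.val_pow_eq_pow_val]
        exact pow_mem hinv _
  have hfin : FiniteDimensional K L := by
    have h1 : Module.Finite K (Algebra.adjoin K {(u : L)}) :=
      Module.Finite.iff_fg.mpr hint.fg_adjoin_singleton
    rw [htop] at h1
    exact Module.Finite.equiv Subalgebra.topEquiv.toLinearEquiv
  have hchar : CharZero L := charZero_of_injective_algebraMap (algebraMap K L).injective
  exact ⟨@NumberField.mk _ _ hchar (Module.Finite.trans K L), hfin, htop⟩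

/-- The horizontal curve attached to a closed torsion point `P` of `𝔾_{m,K}`: with `L` the residue
field of `P` and `n` the order, evaluation at the image of `T` is a homomorphism `φ` to the ring
of integers of `L`, and `f` is the integral minimal polynomial of the image of `T`. -/
theorem exists_ringHom_of_surjective [NumberField K] {L : Type*} [Field L] (ev : K[T;T⁻¹] →+* L)
    (hev : Function.Surjective ev) {n : ℕ} (hn : 0 < n)
    (hT : LaurentPolynomial.T (n : ℤ) - 1 ∈ RingHom.ker ev) :
    NumberField L ∧ ∃ (φ : (𝓞 K)[T;T⁻¹] →+* 𝓞 L) (f : (𝓞 K)[X]),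
      φ.IsIntegral ∧ (∀ b, ∃ a, φ a = n * b) ∧ f.Monic ∧ Irreducible f ∧ f ∣ X ^ n - 1 ∧
      (∀ I, RingHom.ker φ ≤ I ↔ toLaurent f ∈ I) ∧
      ∀ Q, RingHom.ker ev ≤ Q ↔ toLaurent (f.map (algebraMap (𝓞 K) K)) ∈ Q := by
  let alg : Algebra K L := (ev.comp LaurentPolynomial.C).toAlgebra
  have hC : ∀ r, ev (LaurentPolynomial.C r) = algebraMap K L r := fun _ ↦ rfl
  clear_value alg
  obtain ⟨u, rfl⟩ := exists_eq_laurentEval ev hC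
  rw [T_sub_one_mem_ker_iff] at hT
  obtain ⟨hL, hfin, htop⟩ := numberField_of_laurentEval u hev hn hT
  refine ⟨hL, ?_⟩
  have hint : IsIntegral ℤ (u : L) := ⟨X ^ n - 1, monic_X_pow_sub_C 1 hn.ne', by simp [hT]⟩
  let x : 𝓞 L := ⟨u, hint⟩
  have hxn : x ^ n = 1 := RingOfIntegers.coe_injective (by
    rw [map_pow, map_one]
    exact hT)
  let v : (𝓞 L)ˣ := Units.ofPowEqOne x n hxn hn.ne'
  have hv : algebraMap (𝓞 L) L (v : 𝓞 L) = u := rfl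
  have hvn : (v : 𝓞 L) ^ n = 1 := hxn
  have hvint : IsIntegral (𝓞 K) (v : 𝓞 L) := Algebra.IsIntegral.isIntegral _
  refine ⟨laurentEval v, minpoly (𝓞 K) (v : 𝓞 L), laurentEval_isIntegral v,
    fun b ↦ range_laurentEval_of_mem_adjoin v ?_, minpoly.monic hvint, minpoly.irreducible hvint,
    minpoly.isIntegrallyClosed_dvd hvint (by simp [hvn]), ker_laurentEval_le_iff v hvint, ?_⟩
  · exact natCast_mul_mem_adjoin K (L := L) (by rw [hv]; exact htop) hvn hn b
  · intro Q
    rw [ker_laurentEval_le_iff u (Algebra.IsIntegral.isIntegral _),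
      ← hv, minpoly.isIntegrallyClosed_eq_field_fractions K L hvint]

variable [NumberField K]

theorem exists_ringHom_residueField (P : ClosedTorsionPoint K) :
    NumberField ((Gm K).residueField P.1) ∧
    ∃ (φ : (𝓞 K)[T;T⁻¹] →+* 𝓞 ((Gm K).residueField P.1)) (f : (𝓞 K)[X]),
      φ.IsIntegral ∧ (∀ b, ∃ a, φ a = pointOrder K P.1 * b) ∧ f.Monic ∧ Irreducible f ∧
      f ∣ X ^ (pointOrder K P.1) - 1 ∧ (∀ I, RingHom.ker φ ≤ I ↔ toLaurent f ∈ I) ∧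
      ∀ Q, pointIdeal P.1 ≤ Q ↔ toLaurent (f.map (algebraMap (𝓞 K) K)) ∈ Q := by
  obtain ⟨ev, hev, hker⟩ := exists_surjective_residueField P.2.1
  rw [← hker]
  exact exists_ringHom_of_surjective ev hev (pointOrder_pos P.2.2)
    (hker ▸ T_pointOrder_sub_one_mem P.2.2)

/-- Every monic irreducible factor of `X ^ n - 1` over `𝓞 K` is the equation of a closed torsion
point of `𝔾_{m,K}`. -/
theorem exists_closedTorsionPoint {f : (𝓞 K)[X]} (hf : f.Monic) (hfi : Irreducible f) {n : ℕ}
    (hn : 0 < n) (hfn : f ∣ X ^ n - 1) :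
    ∃ P : ClosedTorsionPoint K, toLaurent (f.map (algebraMap (𝓞 K) K)) ∈ pointIdeal P.1 ∧
      LaurentPolynomial.T (n : ℤ) - 1 ∈ pointIdeal P.1 := by
  set F := f.map (algebraMap (𝓞 K) K) with hF
  have hFi : Irreducible F := (hf.irreducible_iff_irreducible_map_fraction_map (K := K)).mp hfi
  have : Fact (Irreducible F) := ⟨hFi⟩
  have h0 : aeval (AdjoinRoot.root F) F = 0 := (AdjoinRoot.aeval_eq F).trans AdjoinRoot.mk_self
  have hroot : AdjoinRoot.root F ^ n = 1 := by
    have h1 : F ∣ X ^ n - 1 := by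
      simpa [hF] using Polynomial.map_dvd (algebraMap (𝓞 K) K) hfn
    obtain ⟨g, hg⟩ := h1
    have h2 := congrArg (aeval (AdjoinRoot.root F)) hg
    rw [map_mul, h0, zero_mul] at h2
    simpa [sub_eq_zero] using h2
  let u : (AdjoinRoot F)ˣ := Units.ofPowEqOne _ n hroot hn.ne'
  have hsurj : Function.Surjective (laurentEval (R := K) u) := fun b ↦ by
    obtain ⟨p, rfl⟩ := AdjoinRoot.mk_surjective b
    exact ⟨toLaurent p, by rw [laurentEval_toLaurent, ← AdjoinRoot.aeval_eq]; rfl⟩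
  have hmax : (RingHom.ker (laurentEval (R := K) u)).IsMaximal :=
    RingHom.ker_isMaximal_of_surjective _ hsurj
  let P : Gm K := (⟨RingHom.ker (laurentEval (R := K) u), hmax.isPrime⟩ :
    PrimeSpectrum K[T;T⁻¹])
  have hT : LaurentPolynomial.T (n : ℤ) - 1 ∈ pointIdeal P :=
    (T_sub_one_mem_ker_iff u n).mpr hroot
  refine ⟨⟨P, (mem_closedPoints_iff_isMaximal P).mpr hmax, n, hn,
    (mem_range_muIncl_iff n P).mpr hT⟩, ?_, hT⟩
  change laurentEval u (toLaurent F) = 0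
  rw [laurentEval_toLaurent]
  exact h0

/-- The homomorphism from Laurent polynomials over `𝓞 K` to the ring of integers of the residue
field of a closed torsion point. -/
noncomputable def torsionEval (P : ClosedTorsionPoint K) :
    (𝓞 K)[T;T⁻¹] →+* 𝓞 ((Gm K).residueField P.1) :=
  (exists_ringHom_residueField P).2.choose

/-- The closed points of `𝔾_m` over `𝓞 K` are the disjoint union over the closed torsion points `P`
of `𝔾_{m,K}` of the primes of the residue field of `P` not dividing the order of `P`. -/
theorem existsUnique_ker_torsionEval_le (M : MaximalSpectrum (𝓞 K)[T;T⁻¹]) :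
    ∃! P : ClosedTorsionPoint K, RingHom.ker (torsionEval P) ≤ M.asIdeal ∧
      ((pointOrder K P.1 : ℕ) : (𝓞 K)[T;T⁻¹]) ∉ M.asIdeal := by
  have := isJacobsonRing_ringOfIntegers K
  have := finite_quotient_of_finiteType (finite_quotient_ringOfIntegers K) M
  have hM := M.isMaximal.isPrime
  choose f h1 h2 hf hfi hfdvd hfM hfQ using
    fun P : ClosedTorsionPoint K ↦ (exists_ringHom_residueField P).2.choose_spec
  have hker : ∀ P I, RingHom.ker (torsionEval P) ≤ I ↔ toLaurent (f P) ∈ I := hfM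
  simp only [hker]
  have hdvd : ∀ {R : Type u} [CommRing R] {g : R[X]} {m n : ℕ}, m ∣ n → g ∣ X ^ m - 1 →
      g ∣ X ^ n - 1 := by
    rintro R _ g m _ ⟨k, rfl⟩ h
    rw [pow_mul]
    exact h.trans (by simpa using sub_dvd_pow_sub_pow (X ^ m : R[X]) 1 k)
  obtain ⟨n, hn, hnM, hTM⟩ := exists_T_sub_one_mem M
  rw [← toLaurent_X_pow_sub_one] at hTM
  obtain ⟨g, hg, hgi, hgn, hgM⟩ := exists_monic_irreducible_dvd (M.asIdeal.comap toLaurent)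
    (monic_X_pow_sub_C 1 hn.ne') (by simpa using hTM)
  rw [map_one] at hgn
  obtain ⟨P, hP, hPT⟩ := exists_closedTorsionPoint hg hgi hn hgn
  have hPn := pointOrder_dvd P.2.2 hPT
  -- both `g` and the equation of `P` vanish at `P`, and `n` is invertible there
  have hgP : f P = g := by
    refine Polynomial.map_injective (algebraMap (𝓞 K) K) RingOfIntegers.coe_injective ?_
    refine eq_of_dvd_X_pow_sub_one (n := n) ((hf P).map _) (hg.map _)
      (((hf P).irreducible_iff_irreducible_map_fraction_map (K := K)).mp (hfi P))
      ((hg.irreducible_iff_irreducible_map_fraction_map (K := K)).mp hgi)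
      (by simpa using Polynomial.map_dvd (algebraMap (𝓞 K) K) (hdvd hPn (hfdvd P)))
      (by simpa using Polynomial.map_dvd (algebraMap (𝓞 K) K) hgn) (pointIdeal P.1)
      ((hfQ P _).mp le_rfl) hP fun h ↦ ?_
    have hunit : IsUnit (n : K[T;T⁻¹]) := by
      rw [← map_natCast (LaurentPolynomial.C : K →+* K[T;T⁻¹])]
      exact (IsUnit.mk0 (n : K) (by exact_mod_cast hn.ne')).map _
    exact Ideal.IsPrime.ne_top inferInstance ((pointIdeal P.1).eq_top_of_isUnit_mem h hunit)
  have hPM : ((pointOrder K P.1 : ℕ) : (𝓞 K)[T;T⁻¹]) ∉ M.asIdeal := fun h ↦ hnM <| by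
    obtain ⟨e, rfl⟩ := hPn
    rw [Nat.cast_mul]
    exact M.asIdeal.mul_mem_right _ h
  refine ⟨P, ⟨by rw [hgP]; exact hgM, hPM⟩, ?_⟩
  rintro Q ⟨hQ, hQM⟩
  have hQP : f Q = f P := by
    refine eq_of_dvd_X_pow_sub_one (n := pointOrder K Q.1 * pointOrder K P.1) (hf Q) (hf P) (hfi Q)
      (hfi P) (hdvd (dvd_mul_right _ _) (hfdvd Q)) (hdvd (dvd_mul_left _ _) (hfdvd P))
      M.asIdeal hQ (by rw [hgP]; exact hgM) ?_
    rw [Nat.cast_mul]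
    exact fun h ↦ (hM.mem_or_mem h).elim hQM hPM
  refine Subtype.ext (pointIdeal_injective (le_antisymm ?_ ?_))
  · exact (hfQ Q _).mpr (hQP ▸ (hfQ P _).mp le_rfl)
  · exact (hfQ P _).mpr (hQP ▸ (hfQ Q _).mp le_rfl)

end TorsionPoints

/-! ### The scheme of points of order `n` over the integers -/

section MuStar

open Polynomial

/-- For `t ^ n = 1`, every `1 - t ^ j` with `0 < j < n` divides `1 - t ^ d` for `d = gcd j n`. -/
theorem prod_one_sub_pow_dvd {S : Type*} [CommRing S] {t : S} {n : ℕ} (ht : t ^ n = 1) :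
    ∏ k ∈ Finset.range (n - 1), (1 - t ^ (k + 1)) ∣
      (∏ d ∈ n.properDivisors, (t ^ d - 1)) ^ (n - 1) := by
  have h : ∀ k ∈ Finset.range (n - 1), 1 - t ^ (k + 1) ∣ ∏ d ∈ n.properDivisors, (t ^ d - 1) := by
    intro k hk
    have hk := Finset.mem_range.mp hk
    have hlt : (k + 1).gcd n < n :=
      (Nat.le_of_dvd (by omega) (Nat.gcd_dvd_left _ _)).trans_lt (by omega)
    obtain ⟨m, -, hm⟩ := Nat.exists_mul_mod_eq_gcd hlt
    have h1 : t ^ ((k + 1).gcd n) = (t ^ (k + 1)) ^ m := by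
      rw [← pow_mul, ← hm]
      conv_rhs => rw [← Nat.div_add_mod ((k + 1) * m) n, pow_add, pow_mul, ht, one_pow, one_mul]
    have h2 : 1 - t ^ (k + 1) ∣ 1 - t ^ ((k + 1).gcd n) := by
      simpa [h1] using sub_dvd_pow_sub_pow 1 (t ^ (k + 1)) m
    refine h2.trans ((neg_sub (t ^ ((k + 1).gcd n)) 1 ▸ neg_dvd.mpr dvd_rfl).trans ?_)
    exact Finset.dvd_prod_of_mem (fun d ↦ t ^ d - 1)
      (Nat.mem_properDivisors.mpr ⟨Nat.gcd_dvd_right _ _, hlt⟩)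
  have h3 := Finset.prod_dvd_prod_of_dvd _ _ h
  rwa [Finset.prod_const, Finset.card_range] at h3

theorem X_pow_sub_one_dvd_cyclotomic_mul {n : ℕ} (hn : 0 < n) :
    (X ^ n - 1 : ℤ[X]) ∣ cyclotomic n ℤ * ∏ d ∈ n.properDivisors, (X ^ d - 1) := by
  rw [← prod_cyclotomic_eq_X_pow_sub_one hn, ← Nat.cons_self_properDivisors hn.ne',
    Finset.prod_cons]
  exact mul_dvd_mul_left _ (Finset.prod_dvd_prod_of_dvd _ _ fun d _ ↦
    cyclotomic.dvd_X_pow_sub_one d ℤ)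

/-- The function on `μ_n` whose zeros are the points of order less than `n`. -/
noncomputable def lowerOrder (R : Type u) [CommRing R] (n : ℕ) : MuRing R n :=
  ∏ d ∈ n.properDivisors, ((Ideal.Quotient.mk _ (LaurentPolynomial.T 1) : MuRing R n) ^ d - 1)

theorem mk_T_pow_eq_one (R : Type u) [CommRing R] (n : ℕ) :
    (Ideal.Quotient.mk _ (LaurentPolynomial.T 1) : MuRing R n) ^ n = 1 := by
  rw [← map_pow, LaurentPolynomial.T_pow, mul_one, ← map_one (Ideal.Quotient.mk _),
    Ideal.Quotient.eq]
  exact Ideal.mem_span_singleton_self _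

theorem mem_muStar_iff (R : Type u) [CommRing R] (n : ℕ) (y : Mu R n) :
    y ∈ muStar R n ↔ lowerOrder R n ∉ PrimeSpectrum.asIdeal (R := MuRing R n) y := by
  have h1 : y ∈ muStar R n ↔ ∀ d ∈ n.properDivisors, muIncl R n y ∉ Set.range (muIncl R d) := by
    change y ∈ (⋃ d ∈ n.properDivisors, muIncl R n ⁻¹' Set.range (muIncl R d))ᶜ ↔ _
    simp only [Set.mem_compl_iff, Set.mem_iUnion, not_exists, Set.mem_preimage]
  have h2 : ∀ d : ℕ, LaurentPolynomial.T (d : ℤ) - 1 ∈ pointIdeal (muIncl R n y) ↔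
      (Ideal.Quotient.mk _ (LaurentPolynomial.T 1) : MuRing R n) ^ d - 1 ∈
        PrimeSpectrum.asIdeal (R := MuRing R n) y := fun d ↦ by
    rw [← map_pow, LaurentPolynomial.T_pow, mul_one, ← map_one (Ideal.Quotient.mk _), ← map_sub]
    rfl
  have := PrimeSpectrum.isPrime (R := MuRing R n) y
  rw [h1, lowerOrder, Ideal.IsPrime.prod_mem_iff]
  simp only [mem_range_muIncl_iff, h2, not_exists, not_and]

variable {n : ℕ} {C : Type*} [CommRing C]

/-- The homomorphism from the coordinate ring of `μ_n` given by an `n`-th root of unity. -/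
noncomputable def muEval (u : Cˣ) (hu : (u : C) ^ n = 1) : MuRing ℤ n →+* C :=
  Ideal.Quotient.lift _ (laurentEval (R := ℤ) u) fun a ha ↦ by
    have h : Ideal.span {(LaurentPolynomial.T (n : ℤ) - 1 : ℤ[T;T⁻¹])} ≤
        RingHom.ker (laurentEval (R := ℤ) u) := by
      rw [Ideal.span_singleton_le_iff_mem, T_sub_one_mem_ker_iff]
      exact hu
    exact h ha

theorem muEval_mk (u : Cˣ) (hu : (u : C) ^ n = 1) (a : ℤ[T;T⁻¹]) :
    muEval u hu (Ideal.Quotient.mk _ a) = laurentEval u a :=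
  rfl

theorem muEval_mk_T (u : Cˣ) (hu : (u : C) ^ n = 1) :
    muEval u hu (Ideal.Quotient.mk _ (LaurentPolynomial.T 1)) = u := by
  rw [muEval_mk]
  simp

/-- If `C` is generated by `n⁻¹` and a primitive `n`-th root of unity, then it is the localization
of the coordinate ring of `μ_n` away from the points of order less than `n`. -/
theorem isLocalization_muEval [IsDomain C] [CharZero C] (hn : 0 < n) (u : Cˣ)
    (hu : IsPrimitiveRoot (u : C) n) {w : C} (hw : n * w = 1)
    (hC : Algebra.adjoin ℤ {w, (u : C)} = ⊤) (hmin : minpoly ℤ (u : C) = cyclotomic n ℤ) :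
    letI := (muEval u hu.pow_eq_one).toAlgebra
    IsLocalization.Away (lowerOrder ℤ n) C := by
  let := (muEval u hu.pow_eq_one).toAlgebra
  set ψ := muEval u hu.pow_eq_one with hψ
  have hmap : algebraMap (MuRing ℤ n) C = ψ := rfl
  have hψT := muEval_mk_T u hu.pow_eq_one
  rw [← hψ] at hψT
  -- the product of the `1 - ζ ^ j` is the unit `n`
  have hprod : ∏ k ∈ Finset.range (n - 1), (1 - (u : C) ^ (k + 1)) = n := by
    obtain ⟨m, rfl⟩ : ∃ m, n = m + 1 := ⟨n - 1, by omega⟩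
    rw [Nat.add_sub_cancel, hu.prod_one_sub_pow_eq_order, Nat.cast_succ]
  have hnunit : IsUnit (n : C) := .of_mul_eq_one w hw
  have hunit : IsUnit (ψ (lowerOrder ℤ n)) := by
    rw [lowerOrder, map_prod, IsUnit.prod_iff]
    intro d hd
    rw [map_sub, map_pow, hψT, map_one]
    obtain ⟨hdn, hlt⟩ := Nat.mem_properDivisors.mp hd
    have hd0 := Nat.pos_of_dvd_of_pos hdn hn
    have h1 : 1 - (u : C) ^ d ∣ n := by
      rw [← hprod]
      have := Finset.dvd_prod_of_mem (fun k ↦ 1 - (u : C) ^ (k + 1))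
        (Finset.mem_range.mpr (show d - 1 < n - 1 by omega))
      simpa only [Nat.sub_add_cancel hd0] using this
    rw [← neg_sub, IsUnit.neg_iff]
    exact isUnit_of_dvd_unit h1 hnunit
  rw [IsLocalization.Away, isLocalization_iff, hmap]
  refine ⟨?_, ?_, ?_⟩
  · rintro ⟨_, k, rfl⟩
    rw [map_pow]
    exact hunit.pow k
  · have key : ∀ z : C, ∃ (k : ℕ) (b : MuRing ℤ n), z * ψ (lowerOrder ℤ n ^ k) = ψ b := by
      intro z
      have hz : z ∈ Algebra.adjoin ℤ {w, (u : C)} := hC ▸ Algebra.mem_top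
      induction hz using Algebra.adjoin_induction with
      | mem x hx =>
        rcases hx with rfl | rfl
        · obtain ⟨c, hc⟩ := prod_one_sub_pow_dvd (mk_T_pow_eq_one ℤ n)
          refine ⟨n - 1, c, ?_⟩
          rw [lowerOrder, hc, map_mul, map_prod]
          simp only [map_sub, map_pow, map_one, hψT]
          rw [hprod, ← mul_assoc, mul_comm x, hw, one_mul]
        · exact ⟨0, Ideal.Quotient.mk _ (LaurentPolynomial.T 1),
            by rw [pow_zero, map_one, mul_one, hψT]⟩
      | algebraMap r => exact ⟨0, r, by simp⟩
      | add x y _ _ hx hy =>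
        obtain ⟨k, b, hb⟩ := hx
        obtain ⟨l, c, hc⟩ := hy
        refine ⟨k + l, b * lowerOrder ℤ n ^ l + c * lowerOrder ℤ n ^ k, ?_⟩
        rw [map_add, map_mul, map_mul, ← hb, ← hc, pow_add, map_mul]
        ring
      | mul x y _ _ hx hy =>
        obtain ⟨k, b, hb⟩ := hx
        obtain ⟨l, c, hc⟩ := hy
        refine ⟨k + l, b * c, ?_⟩
        rw [map_mul, ← hb, ← hc, pow_add, map_mul]
        ring
    intro z
    obtain ⟨k, b, hb⟩ := key z
    exact ⟨⟨b, ⟨_, k, rfl⟩⟩, hb⟩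
  · intro x y hxy
    refine ⟨⟨_, 1, rfl⟩, ?_⟩
    obtain ⟨a, ha⟩ := Ideal.Quotient.mk_surjective (x - y)
    have hker : a ∈ RingHom.ker (laurentEval (R := ℤ) u) := by
      rw [RingHom.mem_ker, ← muEval_mk u hu.pow_eq_one, ha, map_sub, sub_eq_zero]
      exact hxy
    -- the functions on `𝔾_m` that vanish on `μ_n` after multiplication by `lowerOrder`
    let I : Ideal ℤ[T;T⁻¹] := Submodule.comap (LinearMap.mulLeft ℤ[T;T⁻¹]
      (∏ d ∈ n.properDivisors, (LaurentPolynomial.T 1 ^ d - 1)))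
      (Ideal.span {(LaurentPolynomial.T (n : ℤ) - 1 : ℤ[T;T⁻¹])})
    have hI : RingHom.ker (laurentEval (R := ℤ) u) ≤ I := by
      have hint : IsIntegral ℤ (u : C) := ⟨X ^ n - 1, monic_X_pow_sub_C 1 hn.ne',
        by simp [hu.pow_eq_one]⟩
      rw [ker_laurentEval_le_iff u hint, hmin]
      change (∏ d ∈ n.properDivisors, (LaurentPolynomial.T 1 ^ d - 1)) *
        toLaurent (cyclotomic n ℤ) ∈ Ideal.span {(LaurentPolynomial.T (n : ℤ) - 1 : ℤ[T;T⁻¹])}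
      rw [Ideal.mem_span_singleton, ← toLaurent_X_pow_sub_one]
      convert map_dvd (toLaurent : ℤ[X] →+* _) (X_pow_sub_one_dvd_cyclotomic_mul hn) using 1
      rw [map_mul, map_prod, mul_comm]
      simp only [map_sub, map_pow, map_one, Polynomial.toLaurent_X]
    have h1 : lowerOrder ℤ n * (x - y) = 0 := by
      have h2 : (∏ d ∈ n.properDivisors, (LaurentPolynomial.T 1 ^ d - 1)) * a ∈
        Ideal.span {(LaurentPolynomial.T (n : ℤ) - 1 : ℤ[T;T⁻¹])} := hI hker
      rw [← Ideal.Quotient.eq_zero_iff_mem, map_mul, ha, map_prod] at h2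
      simp only [map_sub, map_pow, map_one] at h2
      exact h2
    rw [mul_sub, sub_eq_zero] at h1
    simpa using h1

/-- Over the integers, the scheme of points of order `n` is `Spec ℤ[1/n, ζ_n]`. -/
theorem exists_iso_muStar (hn : 0 < n) (ζ : CyclotomicField n ℚ) (hζ : IsPrimitiveRoot ζ n) :
    ∃ (φ : ℤ[T;T⁻¹] →+* cyclotomicSubring n ζ)
      (e : Spec (.of (cyclotomicSubring n ζ)) ≅ (muStar ℤ n : Scheme)),
      (φ (LaurentPolynomial.T 1) : CyclotomicField n ℚ) = ζ ∧
        e.hom ≫ (muStar ℤ n).ι ≫ muIncl ℤ n = Spec.map (CommRingCat.ofHom φ) := by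
  let C := cyclotomicSubring n ζ
  have hinj : Function.Injective (algebraMap C (CyclotomicField n ℚ)) := Subtype.val_injective
  let z : C := ⟨ζ, Algebra.subset_adjoin (by simp)⟩
  let w : C := ⟨(n : CyclotomicField n ℚ)⁻¹, Algebra.subset_adjoin (by simp)⟩
  have hz : IsPrimitiveRoot z n := IsPrimitiveRoot.of_map_of_injective
    (f := algebraMap C (CyclotomicField n ℚ)) hζ hinj
  have hn0 : (n : CyclotomicField n ℚ) ≠ 0 := by exact_mod_cast hn.ne'
  have hw : n * w = 1 := Subtype.ext (mul_inv_cancel₀ hn0)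
  let u : Cˣ := Units.ofPowEqOne z n hz.pow_eq_one hn.ne'
  have hu : IsPrimitiveRoot (u : C) n := hz
  have hC : Algebra.adjoin ℤ {w, (u : C)} = ⊤ := by
    have h1 := Algebra.adjoin_adjoin_coe_preimage (R := ℤ)
      (s := {(n : CyclotomicField n ℚ)⁻¹, ζ})
    have h2 : ({w, (u : C)} : Set C) = Subtype.val ⁻¹' {(n : CyclotomicField n ℚ)⁻¹, ζ} := by
      ext c
      exact or_congr Subtype.ext_iff Subtype.ext_iff
    rw [h2]
    exact h1
  have hmin : minpoly ℤ (u : C) = cyclotomic n ℤ := by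
    rw [cyclotomic_eq_minpoly hζ hn, ← minpoly.algebraMap_eq hinj]
    rfl
  let := (muEval u hu.pow_eq_one).toAlgebra
  have hloc : IsLocalization.Away (lowerOrder ℤ n) C := isLocalization_muEval hn u hu hw hC hmin
  let j : Spec (.of C) ⟶ Mu ℤ n := Spec.map (CommRingCat.ofHom (muEval u hu.pow_eq_one))
  have hj : IsOpenImmersion j := IsOpenImmersion.of_isLocalization (S := C) (lowerOrder ℤ n)
  have hrange : Set.range j = Set.range (muStar ℤ n).ι := by
    rw [Scheme.Opens.range_ι]
    have h1 := PrimeSpectrum.localization_away_comap_range C (lowerOrder ℤ n)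
    refine Eq.trans h1 ?_
    ext y
    exact (mem_muStar_iff ℤ n y).symm
  refine ⟨laurentEval u, IsOpenImmersion.isoOfRangeEq j (muStar ℤ n).ι hrange, ?_, ?_⟩
  · have h1 : laurentEval (R := ℤ) u (LaurentPolynomial.T 1) = u := muEval_mk_T u hu.pow_eq_one
    rw [h1]
    rfl
  · rw [← Category.assoc, IsOpenImmersion.isoOfRangeEq_hom_fac]
    change Spec.map _ ≫ Spec.map _ = _
    rw [← Spec.map_comp]
    rfl

end MuStar

/-! ### The horizontal factorizations -/

section Factorization

open NumberField

theorem summable_normPow_int {s : ℂ} (hs : 1 < s.re) :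
    Summable fun p : MaximalSpectrum ℤ ↦ ‖normPow s p.asIdeal‖ := by
  let φ : 𝓞 ℚ →+* ℤ := Rat.ringOfIntegersEquiv.toRingHom
  have hsurj : Function.Surjective φ := Rat.ringOfIntegersEquiv.surjective
  have hφ : φ.IsIntegral := RingHom.isIntegral_of_surjective φ hsurj
  let i : MaximalSpectrum ℤ → MaximalSpectrum (𝓞 ℚ) := fun p ↦
    ⟨p.asIdeal.comap φ, comap_isMaximal_of_isIntegral hφ p⟩
  have hi : Function.Injective i := fun p q h ↦ MaximalSpectrum.ext
    (Ideal.comap_injective_of_surjective φ hsurj (congrArg MaximalSpectrum.asIdeal h))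
  refine ((summable_normPow_maximalSpectrum ℚ hs).comp_injective hi).congr fun p ↦ ?_
  rw [Function.comp_apply, normPow, normPow, card_quotient_comap (n := 1) hφ (fun _ ↦ hsurj _) p
    (one_notMem_maximalSpectrum p)]

theorem summable_normPow_laurent_int {s : ℂ} (hs : 2 < s.re) :
    Summable fun M : MaximalSpectrum ℤ[T;T⁻¹] ↦ ‖normPow s M.asIdeal‖ :=
  have := isJacobsonRing_int
  summable_normPow_laurent finite_quotient_int hs
    (summable_normPow_int (by rw [Complex.sub_re, Complex.one_re]; linarith))

theorem hasProd_modifiedDedekindZeta_cyclotomicField {s : ℂ} (hs : 2 < s.re) :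
    Multipliable (eulerFactor (Gm ℤ) s) ∧
    (∀ n : ℕ+, Multipliable (modifiedDedekindFactor (CyclotomicField n ℚ) n s)) ∧
    HasProd (fun n : ℕ+ ↦ modifiedDedekindZeta (CyclotomicField n ℚ) n s)
      (hasseWeilZeta (Gm ℤ) s) := by
  have hs1 : 1 < s.re := by linarith
  have hsum := summable_normPow_laurent_int hs
  obtain ⟨h1, h2⟩ := hasProd_tprod_normPow cyclotomicEval (fun n : ℕ+ ↦ (n : ℕ))
    cyclotomicEval_isIntegral exists_cyclotomicEval_eq existsUnique_ker_cyclotomicEval_le hs1 hsum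
  refine ⟨(multipliable_eulerFactor_iff s).mpr (multipliable_normPow hs1 (fun M ↦ M) hsum),
    fun n ↦ (multipliable_modifiedDedekindFactor_iff _ _ s).mpr (h1 n), ?_⟩
  simp only [modifiedDedekindZeta_eq, hasseWeilZeta_eq]
  exact h2

variable (K : Type u) [Field K] [NumberField K]

theorem summable_normPow_laurent_ringOfIntegers {s : ℂ} (hs : 2 < s.re) :
    Summable fun M : MaximalSpectrum (𝓞 K)[T;T⁻¹] ↦ ‖normPow s M.asIdeal‖ :=
  have := isJacobsonRing_ringOfIntegers K
  summable_normPow_laurent (finite_quotient_ringOfIntegers K) hs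
    (summable_normPow_maximalSpectrum K (by rw [Complex.sub_re, Complex.one_re]; linarith))

theorem hasseWeilZeta_Gm_ringOfIntegers {s : ℂ} (hs : 2 < s.re) :
    hasseWeilZeta (Gm (𝓞 K)) s = dedekindZeta K (s - 1) / dedekindZeta K s := by
  have := isJacobsonRing_ringOfIntegers K
  have hs1 : 1 < s.re := by linarith
  have hs2 : 1 < (s - 1).re := by rw [Complex.sub_re, Complex.one_re]; linarith
  rw [eq_div_iff (dedekindZeta_ne_zero K hs1), hasseWeilZeta_eq]
  exact (hasProd_normPow_laurent_mul (finite_quotient_ringOfIntegers K) hs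
    (summable_normPow_maximalSpectrum K hs2) (hasProd_dedekindZeta K hs1)).unique
    (hasProd_dedekindZeta K hs2)

theorem hasProd_modifiedDedekindZeta_residueField {s : ℂ} (hs : 2 < s.re) :
    Multipliable (eulerFactor (Gm (𝓞 K)) s) ∧
    (∀ P : ClosedTorsionPoint K, Multipliable (modifiedDedekindFactor
      ((Gm K).residueField P.1) (pointOrder K P.1) s)) ∧
    HasProd (fun P : ClosedTorsionPoint K ↦ modifiedDedekindZeta
      ((Gm K).residueField P.1) (pointOrder K P.1) s) (hasseWeilZeta (Gm (𝓞 K)) s) := by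
  have hs1 : 1 < s.re := by linarith
  have hsum := summable_normPow_laurent_ringOfIntegers K hs
  have hL : ∀ P : ClosedTorsionPoint K, NumberField ((Gm K).residueField P.1) :=
    fun P ↦ (exists_ringHom_residueField P).1
  obtain ⟨h1, h2⟩ := hasProd_tprod_normPow torsionEval
    (fun P : ClosedTorsionPoint K ↦ pointOrder K P.1)
    (fun P ↦ (exists_ringHom_residueField P).2.choose_spec.choose_spec.1)
    (fun P ↦ (exists_ringHom_residueField P).2.choose_spec.choose_spec.2.1)
    existsUnique_ker_torsionEval_le hs1 hsum
  refine ⟨(multipliable_eulerFactor_iff s).mpr (multipliable_normPow hs1 (fun M ↦ M) hsum),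
    fun P ↦ (multipliable_modifiedDedekindFactor_iff _ _ s).mpr (h1 P), ?_⟩
  simp only [modifiedDedekindZeta_eq, hasseWeilZeta_eq]
  exact h2

end Factorization

end GmZeta

theorem mainTheorem2 :
    -- the case of a general number field
    (∀ (K : Type u) [Field K] [NumberField K],
      -- the residue fields of closed torsion points are number fields
      (∀ P : GmZeta.ClosedTorsionPoint K, NumberField ((GmZeta.Gm K).residueField P.1)) ∧
      ∀ s : ℂ, 2 < s.re →
        -- convergence of the Euler products
        Multipliable (GmZeta.eulerFactor (GmZeta.Gm (NumberField.RingOfIntegers K)) s) ∧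
        (∀ P : GmZeta.ClosedTorsionPoint K,
          Multipliable (GmZeta.modifiedDedekindFactor
            ((GmZeta.Gm K).residueField P.1) (GmZeta.pointOrder K P.1) s)) ∧
        -- the zeta function of the multiplicative group
        NumberField.dedekindZeta K s ≠ 0 ∧
        GmZeta.hasseWeilZeta (GmZeta.Gm (NumberField.RingOfIntegers K)) s =
          NumberField.dedekindZeta K (s - 1) / NumberField.dedekindZeta K s ∧
        -- the horizontal factorization
        HasProd (fun P : GmZeta.ClosedTorsionPoint K ↦
            GmZeta.modifiedDedekindZeta
              ((GmZeta.Gm K).residueField P.1) (GmZeta.pointOrder K P.1) s)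
          (GmZeta.hasseWeilZeta (GmZeta.Gm (NumberField.RingOfIntegers K)) s)) ∧
    -- over the integers: the points of order `n` form `Spec ℤ[1/n, ζ_n]`, embedded via `T ↦ ζ_n`
    (∀ (n : ℕ), 0 < n → ∀ ζ : CyclotomicField n ℚ, IsPrimitiveRoot ζ n →
      ∃ (φ : ℤ[T;T⁻¹] →+* GmZeta.cyclotomicSubring n ζ)
        (e : Spec (.of (GmZeta.cyclotomicSubring n ζ)) ≅ (GmZeta.muStar ℤ n : Scheme)),
        (φ (LaurentPolynomial.T 1) : CyclotomicField n ℚ) = ζ ∧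
          e.hom ≫ (GmZeta.muStar ℤ n).ι ≫ GmZeta.muIncl ℤ n =
            Spec.map (CommRingCat.ofHom φ)) ∧
    -- over the integers: the factorization into cyclotomic zeta functions
    (∀ s : ℂ, 2 < s.re →
      Multipliable (GmZeta.eulerFactor (GmZeta.Gm ℤ) s) ∧
      (∀ n : ℕ+, Multipliable (GmZeta.modifiedDedekindFactor (CyclotomicField n ℚ) n s)) ∧
      HasProd (fun n : ℕ+ ↦ GmZeta.modifiedDedekindZeta (CyclotomicField n ℚ) n s)
        (GmZeta.hasseWeilZeta (GmZeta.Gm ℤ) s)) := by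
  refine ⟨fun K _ _ ↦ ⟨fun P ↦ (GmZeta.exists_ringHom_residueField P).1, fun s hs ↦ ?_⟩,
    fun n hn ζ hζ ↦ GmZeta.exists_iso_muStar hn ζ hζ,
    fun s hs ↦ GmZeta.hasProd_modifiedDedekindZeta_cyclotomicField hs⟩
  obtain ⟨h1, h2, h3⟩ := GmZeta.hasProd_modifiedDedekindZeta_residueField K hs
  exact ⟨h1, h2, GmZeta.dedekindZeta_ne_zero K (by linarith),
    GmZeta.hasseWeilZeta_Gm_ringOfIntegers K hs, h3⟩
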